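/- Let $G$ be a generalized Baumslag–Solitar (GBS) group, i.e. a group isomorphic to the fundamental group of a finite connected graph of groups whose vertex and edge groups are all infinite cyclic, and assume that $G$ is not solvable. Let $\mathcal D$ be the cyclic deformation space of $G$: the set of minimal metric simplicial $G$-trees (with $G$ acting by simplicial isometries without inversions, and edges of positive length) with cyclic vertex and edge stabilizers, two trees being identified if there is a $G$-equivariant isometry or homothety between them. For $T,T'$ in $\mathcal D$ put $$\operatorname{Lip}(T,T')=\inf_f \operatorname{Lip}(f),\qquad d_{\operatorname{Lip}}(T,T')=\log\left[\operatorname{Lip}(T,T')\,\frac{\operatorname{vol}(T/G)}{\operatorname{vol}(T'/G)}\right],$$ where $f$ ranges over the $G$-equivariant Lipschitz maps $T\to T'$, $\operatorname{Lip}(f)$ is the Lipschitz constant of $f$, and $\operatorname{vol}(T/G)$ is the sum of the lengths of the edges of the quotient graph $T/G$. Then $d_{\operatorname{Lip}}$ is well defined on $\mathcal D$: the graph $T/G$ is finite with positive volume, equivariant Lipschitz maps $T\to T'$ exist, $\operatorname{Lip}(T,T')>0$, and $d_{\operatorname{Lip}}(T,T')$ does not change when $T$ and $T'$ are replaced by equivariantly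 isometric or homothetic trees. Moreover: 1. $d_{\operatorname{Lip}}(T,T')\ge 0$ for all $T,T'\in\mathcal D$; 2. $d_{\operatorname{Lip}}(T,T'')\le d_{\operatorname{Lip}}(T,T')+d_{\operatorname{Lip}}(T',T'')$ for all $T,T',T''\in\mathcal D$; 3. $d_{\operatorname{Lip}}$ may fail to be symmetric: there exist a non-solvable GBS group $G$ and $T,T'\in\mathcal D$ with $d_{\operatorname{Lip}}(T,T')\ne d_{\operatorname{Lip}}(T',T)$. -/

import Mathlib

universe u v

noncomputable section

/-! ### Graphs of groups and generalized Baumslag-Solitar groups -/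

/-- A graph of groups. The underlying graph is given by its vertices and one oriented
representative `e` of each geometric edge, from `o e` to `t e` (loops and multiple edges are
allowed). The edge group `Ge e` embeds in the vertex groups at both ends. -/
structure GraphOfGroups where
  V : Type
  E : Type
  o : E → V
  t : E → V
  Gv : V → Type
  Ge : E → Type
  [groupV : ∀ v, Group (Gv v)]
  [groupE : ∀ e, Group (Ge e)]
  ιo : ∀ e, Ge e →* Gv (o e)
  ιt : ∀ e, Ge e →* Gv (t e)
  ιo_injective : ∀ e, Function.Injective (ιo e)
  ιt_injective : ∀ e, Function.Injective (ιt e)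

namespace GraphOfGroups

attribute [instance] GraphOfGroups.groupV GraphOfGroups.groupE

variable (Γ : GraphOfGroups)

/-- `τ` is (the edge set of) a maximal subtree: it has no loops and no multiple edges, and together
with all the vertices it forms a tree. In particular the graph is then connected. -/
def IsMaximalSubtree (τ : Set Γ.E) : Prop :=
  (∀ e ∈ τ, Γ.o e ≠ Γ.t e) ∧
  Set.InjOn (fun e => s(Γ.o e, Γ.t e)) τ ∧
  (SimpleGraph.fromEdgeSet ((fun e => s(Γ.o e, Γ.t e)) '' τ)).IsTree

/-- The generator given by an element of a vertex group. -/
def vgen (v : Γ.V) (g : Γ.Gv v) : FreeGroup ((Σ v, Γ.Gv v) ⊕ Γ.E) :=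
  FreeGroup.of (Sum.inl ⟨v, g⟩)

/-- The generator given by an edge (the reversed edge gives its inverse). -/
def egen (e : Γ.E) : FreeGroup ((Σ v, Γ.Gv v) ⊕ Γ.E) :=
  FreeGroup.of (Sum.inr e)

/-- The relations of the fundamental group: those of the vertex groups, the relations
`t_e ι_t(h) t_e⁻¹ = ι_o(h)`, and `t_e = 1` for `e` in the maximal subtree. -/
inductive Rel (τ : Set Γ.E) : FreeGroup ((Σ v, Γ.Gv v) ⊕ Γ.E) → Prop
  | vertex (v : Γ.V) (g h : Γ.Gv v) :
      Rel τ (Γ.vgen v g * Γ.vgen v h * (Γ.vgen v (g * h))⁻¹)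
  | edge (e : Γ.E) (h : Γ.Ge e) :
      Rel τ (Γ.egen e * Γ.vgen (Γ.t e) (Γ.ιt e h) * (Γ.egen e)⁻¹ *
        (Γ.vgen (Γ.o e) (Γ.ιo e h))⁻¹)
  | tree (e : Γ.E) (he : e ∈ τ) : Rel τ (Γ.egen e)

/-- The fundamental group of a graph of groups with respect to a maximal subtree. -/
abbrev FundamentalGroup (τ : Set Γ.E) : Type :=
  PresentedGroup {r | Γ.Rel τ r}

end GraphOfGroups

/-- A generalized Baumslag-Solitar group: isomorphic to the fundamental group of a finite
(connected) graph of groups with infinite cyclic vertex and edge groups. -/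
def IsGBS (G : Type u) [Group G] : Prop :=
  ∃ (Γ : GraphOfGroups) (τ : Set Γ.E),
    Finite Γ.V ∧ Finite Γ.E ∧
    (∀ v, IsCyclic (Γ.Gv v) ∧ Infinite (Γ.Gv v)) ∧
    (∀ e, IsCyclic (Γ.Ge e) ∧ Infinite (Γ.Ge e)) ∧
    Γ.IsMaximalSubtree τ ∧
    Nonempty (G ≃* Γ.FundamentalGroup τ)

/-! ### Metric simplicial `G`-trees -/

/-- A metric simplicial tree with a simplicial action of `G`, without inversions, preserving the
edge lengths. Only the values of `len` on edges matter. -/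
structure GTree (G : Type u) [Group G] where
  V : Type v
  graph : SimpleGraph V
  isTree : graph.IsTree
  [action : MulAction G V]
  adj_smul : ∀ (g : G) (a b : V), graph.Adj a b → graph.Adj (g • a) (g • b)
  no_inversion : ∀ (g : G) (a b : V), graph.Adj a b → ¬ (g • a = b ∧ g • b = a)
  len : Sym2 V → ℝ
  len_pos : ∀ a b : V, graph.Adj a b → 0 < len s(a, b)
  len_smul : ∀ (g : G) (a b : V), graph.Adj a b → len s(g • a, g • b) = len s(a, b)

namespace GTree

attribute [instance] GTree.action

variable {G : Type u} [Group G]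

/-- There is no proper `G`-invariant subtree. (A subtree is determined by its set of vertices.) -/
def IsMinimal (T : GTree.{u, v} G) : Prop :=
  ∀ S : Set T.V, (∀ (g : G), ∀ a ∈ S, g • a ∈ S) → (T.graph.induce S).Connected → S = Set.univ

/-- The tree represents a point of the cyclic deformation space of `G`: it is minimal with cyclic
vertex stabilizers and cyclic (pointwise) edge stabilizers. -/
def IsCyclicMinimal (T : GTree.{u, v} G) : Prop :=
  T.IsMinimal ∧
  (∀ a : T.V, IsCyclic (MulAction.stabilizer G a)) ∧
  (∀ a b : T.V, T.graph.Adj a b →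
    IsCyclic (MulAction.stabilizer G a ⊓ MulAction.stabilizer G b : Subgroup G))

/-! #### The volume of the quotient graph -/

instance edgeAction (T : GTree.{u, v} G) : MulAction G T.graph.edgeSet where
  smul g e := ⟨Sym2.map (fun a => g • a) e.1, by
    obtain ⟨e, he⟩ := e
    induction e using Sym2.ind with
    | _ a b => exact T.adj_smul g a b he⟩
  one_smul e := by
    apply Subtype.ext
    change Sym2.map (fun a => (1 : G) • a) e.1 = e.1
    simp
  mul_smul g h e := by
    apply Subtype.ext
    change Sym2.map (fun a => (g * h) • a) e.1
      = Sym2.map (fun a => g • a) (Sym2.map (fun a => h • a) e.1)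
    rw [Sym2.map_map]
    congr 1
    funext a
    exact mul_smul g h a

/-- The edges of the quotient graph `T/G`. -/
abbrev QuotientEdge (T : GTree.{u, v} G) : Type v :=
  MulAction.orbitRel.Quotient G T.graph.edgeSet

/-- The length of an edge of the quotient graph: that of any of its lifts. -/
def quotientLen (T : GTree.{u, v} G) (q : T.QuotientEdge) : ℝ :=
  Quotient.liftOn q (fun e : T.graph.edgeSet => T.len e.1) (by
    rintro e f ⟨g, rfl⟩
    obtain ⟨f, hf⟩ := f
    induction f using Sym2.ind with
    | _ a b => exact T.len_smul g a b hf)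

/-- The volume of `T/G`: the sum of the lengths of its edges. -/
def vol (T : GTree.{u, v} G) : ℝ :=
  ∑ᶠ q : T.QuotientEdge, T.quotientLen q

/-! #### The geometric realization and its path metric -/

/-- The point `(1 - s) a + s b`, in barycentric coordinates. -/
def bary {V : Type v} (a b : V) (s : ℝ) : V →₀ ℝ :=
  Finsupp.single a (1 - s) + Finsupp.single b s

/-- The geometric realization, in barycentric coordinates: vertices, and points of edges. -/
def Realization (T : GTree.{u, v} G) : Type v :=
  {x : T.V →₀ ℝ // ∃ a b : T.V, (a = b ∨ T.graph.Adj a b) ∧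
    ∃ s ∈ Set.Icc (0 : ℝ) 1, x = bary a b s}

theorem mapDomain_bary {V : Type v} {W : Type v} (φ : V → W) (a b : V) (s : ℝ) :
    Finsupp.mapDomain φ (bary a b s) = bary (φ a) (φ b) s := by
  simp only [bary, Finsupp.mapDomain_add, Finsupp.mapDomain_single]

/-- `G` acts on the realization by permuting the barycentric coordinates. -/
instance realizationAction (T : GTree.{u, v} G) : MulAction G T.Realization where
  smul g x := ⟨Finsupp.mapDomain (fun a => g • a) x.1, by
    obtain ⟨x, a, b, hab, s, hs, rfl⟩ := x
    refine ⟨g • a, g • b, ?_, s, hs, mapDomain_bary _ a b s⟩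
    rcases hab with rfl | hab
    · exact Or.inl rfl
    · exact Or.inr (T.adj_smul g a b hab)⟩
  one_smul x := by
    apply Subtype.ext
    change Finsupp.mapDomain (fun a => (1 : G) • a) x.1 = x.1
    simp only [one_smul]
    exact Finsupp.mapDomain_id
  mul_smul g h x := by
    apply Subtype.ext
    change Finsupp.mapDomain (fun a => (g * h) • a) x.1
      = Finsupp.mapDomain (fun a => g • a) (Finsupp.mapDomain (fun a => h • a) x.1)
    rw [← Finsupp.mapDomain_comp]
    congr 1
    funext a
    exact mul_smul g h a

/-- The point `x` lies on the closed segment of the edge from `a` to `b`. -/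
def OnEdge (T : GTree.{u, v} G) (a b : T.V) (x : T.Realization) : Prop :=
  ∃ s ∈ Set.Icc (0 : ℝ) 1, x.1 = bary a b s

/-- `T.PathLen x y r`: some broken path from `x` to `y` consisting of finitely many pieces, each
inside one closed edge, has length `r`. The segment of the edge `ab` has length `len ab`, and
the points `(1 - s) a + s b` and `(1 - s') a + s' b` are at distance `len ab * |s - s'|` in it. -/
inductive PathLen (T : GTree.{u, v} G) : T.Realization → T.Realization → ℝ → Prop
  | nil (x : T.Realization) : PathLen T x x 0
  | cons {x y z : T.Realization} {r : ℝ} (a b : T.V) (hab : T.graph.Adj a b)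
      (hx : T.OnEdge a b x) (hy : T.OnEdge a b y) (h : PathLen T y z r) :
      PathLen T x z (T.len s(a, b) * |x.1 b - y.1 b| + r)

variable {T : GTree.{u, v} G}

theorem PathLen.nonneg {x y : T.Realization} {r : ℝ} (h : T.PathLen x y r) : 0 ≤ r := by
  induction h with
  | nil x => exact le_rfl
  | cons a b hab hx hy h ih =>
    exact add_nonneg (mul_nonneg (T.len_pos a b hab).le (abs_nonneg _)) ih

theorem PathLen.trans {x y z : T.Realization} {r s : ℝ} (h : T.PathLen x y r)
    (h' : T.PathLen y z s) : T.PathLen x z (r + s) := by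
  induction h with
  | nil x => simpa using h'
  | cons a b hab hx hy h ih =>
    rw [add_assoc]
    exact PathLen.cons a b hab hx hy (ih h')

theorem PathLen.symm {x y : T.Realization} {r : ℝ} (h : T.PathLen x y r) :
    T.PathLen y x r := by
  induction h with
  | nil x => exact PathLen.nil x
  | @cons x y z r a b hab hx hy h ih =>
    have h1 := ih.trans (PathLen.cons a b hab hy hx (PathLen.nil x))
    rwa [add_zero, abs_sub_comm, add_comm] at h1

/-- The path metric on the geometric realization: the infimum of the lengths of paths. -/
instance realizationMetric (T : GTree.{u, v} G) : PseudoEMetricSpace T.Realization where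
  edist x y := ⨅ (r : ℝ) (_ : T.PathLen x y r), ENNReal.ofReal r
  edist_self x := by
    refine le_antisymm ?_ zero_le
    exact (iInf₂_le (0 : ℝ) (PathLen.nil x)).trans (by simp)
  edist_comm x y := by
    refine le_antisymm ?_ ?_ <;>
    exact le_iInf₂ fun r h => iInf₂_le r h.symm
  edist_triangle x y z := by
    simp only [ENNReal.iInf_add, ENNReal.add_iInf]
    refine le_iInf₂ fun r h => le_iInf₂ fun s h' => ?_
    rw [← ENNReal.ofReal_add h'.nonneg h.nonneg]
    exact iInf₂_le _ (h'.trans h)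

/-! #### The Lipschitz metric -/

/-- Two trees are identified in the deformation space if there is a `G`-equivariant isometry or
homothety between them. -/
def Equivalent (T T' : GTree.{u, v} G) : Prop :=
  ∃ φ : T.Realization ≃ᵈ T'.Realization, ∀ (g : G) (x : T.Realization), φ (g • x) = g • φ x

/-- The `G`-equivariant Lipschitz maps from `T` to `T'`. -/
def LipMap (T T' : GTree.{u, v} G) : Type v :=
  {f : T.Realization → T'.Realization //
    (∀ (g : G) (x : T.Realization), f (g • x) = g • f x) ∧ ∃ K : NNReal, LipschitzWith K f}

/-- The Lipschitz constant of a map: the least `K` such that it is `K`-Lipschitz. -/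
def LipMap.const {T T' : GTree.{u, v} G} (f : LipMap T T') : ℝ :=
  ((sInf {K : NNReal | LipschitzWith K f.1} : NNReal) : ℝ)

/-- `Lip(T, T')`, the infimum of the Lipschitz constants of equivariant Lipschitz maps. -/
def Lip (T T' : GTree.{u, v} G) : ℝ :=
  ⨅ f : LipMap T T', f.const

/-- The Lipschitz metric `d_Lip(T, T')`. -/
def dLip (T T' : GTree.{u, v} G) : ℝ :=
  Real.log (Lip T T' * (T.vol / T'.vol))

end GTree

end

/-! The analytic heart is a comparison of volumes. An equivariant continuous map `f` from `T` to a
minimal tree `T'` covers every open edge of `T'`: by minimality each orbit meets both sides of the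
edge, and the realization is connected, so the intermediate value theorem applies to the projection
onto the edge. If `f` is `K`-Lipschitz, cutting a finite set of representative edges of `T`
according to the edge of `T'` they hit gives vol(T'/G) ≤ K vol(T/G) (`vol_le_of_lipschitzWith`).
Taking the infimum over `f` gives nonnegativity and `Lip T T' > 0`. The triangle inequality holds
because Lipschitz constants multiply under composition. A homothety of ratio `ρ` and its inverse
give distance zero, so invariance under equivalence follows from the triangle inequality.

Equivariant maps must also exist, and this is where non-solvability enters. A GBS group is finitely
generated and has an element `a` of infinite order commensurated by the whole group. If `a`
translated along an axis in `T`, conjugation invariance of translation lengths would force g a^p g⁻¹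
= a^(±p); finite generation gives one power `z` with g z g⁻¹ = z^(±1) for all `g`. The vertices
moved least by `z` then form an invariant subtree, hence all of `T`, so `T` is a line and `G` is
solvable (`isSolvable_of_normal_translation`). So `a` is elliptic in every tree of the space. By
minimality each vertex stabilizer contains a nontrivial power of `a`; its generator is a root of
that power, hence elliptic in `T'` too. Thus vertex stabilizers of `T` fix vertices of `T'`, an
equivariant vertex map exists, and it extends along geodesics.

For asymmetry, let F₂ × ℤ act on the Cayley tree of F₂ with edge lengths (1, 3) and (2, 2). The
volumes agree, but the optimal stretch is at least 2 one way and at most 3/2 the other. -/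

noncomputable section

/-! ### Distances and geodesics in simplicial trees -/

namespace SimpleGraph.IsTree

variable {V : Type*} {Γ : SimpleGraph V}

theorem length_eq_dist (hΓ : Γ.IsTree) {x y : V} (p : Γ.Walk x y) (hp : p.IsPath) :
    p.length = Γ.dist x y := by
  obtain ⟨q, hq, hl⟩ := hΓ.connected.exists_path_of_dist x y
  rw [← hl, (hΓ.existsUnique_path x y).unique hp hq]

/-- Local geodesics are geodesics: two overlapping geodesics `x, y, z` and `y, z, w` glue. -/
theorem dist_eq_of_overlap (hΓ : Γ.IsTree) {x y z w : V}
    (h1 : Γ.dist x z = Γ.dist x y + Γ.dist y z) (h2 : Γ.dist y w = Γ.dist y z + Γ.dist z w)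
    (hyz : y ≠ z) : Γ.dist x w = Γ.dist x y + Γ.dist y z + Γ.dist z w := by
  obtain ⟨p, -, hp⟩ := hΓ.connected.exists_path_of_dist x y
  obtain ⟨q, -, hq⟩ := hΓ.connected.exists_path_of_dist y z
  obtain ⟨r, -, hr⟩ := hΓ.connected.exists_path_of_dist z w
  have hpq : (p.append q).IsPath := by
    apply Walk.isPath_of_length_eq_dist
    rw [Walk.length_append]; omega
  have hqr : (q.append r).IsPath := by
    apply Walk.isPath_of_length_eq_dist
    rw [Walk.length_append]; omega
  -- In an acyclic graph a walk is a path as soon as consecutive edges differ. This condition is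
  -- local, so it passes to the glued walk because the overlap `q` is nonempty.
  have hpqr : ((p.append q).append r).IsPath := by
    rw [hΓ.isAcyclic.isPath_iff_isChain] at hpq hqr ⊢
    rw [Walk.edges_append] at hpq hqr
    rw [Walk.edges_append, Walk.edges_append]
    refine hpq.append_overlap hqr ?_
    intro h0
    have : q.length = 0 := by rw [← Walk.length_edges, h0]; rfl
    exact hyz (Walk.eq_of_length_eq_zero this)
  rw [← hΓ.length_eq_dist _ hpqr, Walk.length_append, Walk.length_append, hp, hq, hr]

theorem exists_adj_closer (hΓ : Γ.IsTree) {v w : V} (h : v ≠ w) :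
    ∃ x, Γ.Adj v x ∧ Γ.dist x w + 1 = Γ.dist v w := by
  obtain ⟨p, -, hp⟩ := hΓ.connected.exists_path_of_dist v w
  cases p with
  | nil => exact absurd rfl h
  | @cons _ x _ hx p =>
    refine ⟨x, hx, ?_⟩
    have h1 := dist_le p
    have h2 := hΓ.dist_eq_dist_add_one_of_adj w hx
    rw [Walk.length_cons] at hp
    rw [dist_comm (u := w), dist_comm (u := w)] at h2
    omega

theorem dist_adj_cases (hΓ : Γ.IsTree) (w : V) {v x : V} (h : Γ.Adj v x) :
    Γ.dist w x = Γ.dist w v + 1 ∨ Γ.dist w v = Γ.dist w x + 1 := by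
  have := hΓ.dist_eq_dist_add_one_of_adj w h
  omega

theorem dist_adj_cases' (hΓ : Γ.IsTree) (w : V) {v x : V} (h : Γ.Adj v x) :
    Γ.dist x w = Γ.dist v w + 1 ∨ Γ.dist v w = Γ.dist x w + 1 := by
  rw [dist_comm (u := x), dist_comm (u := v)]
  exact hΓ.dist_adj_cases w h

theorem dist_eq_two (hΓ : Γ.IsTree) {v x y : V} (hx : Γ.Adj v x) (hy : Γ.Adj v y) (hxy : x ≠ y) :
    Γ.dist x y = 2 := by
  have h1 := hΓ.dist_adj_cases x hy
  rw [dist_comm (u := x) (v := v), dist_eq_one_iff_adj.2 hx] at h1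
  have h2 := hΓ.connected.pos_dist_of_ne hxy
  omega

/-- For distinct `x` and `y`, the geodesics `x, v, y` and `v, y, w` would glue, putting `x` farther
from `w` than `v` is. -/
theorem eq_of_adj_closer (hΓ : Γ.IsTree) {v w x y : V} (hx : Γ.Adj v x) (hy : Γ.Adj v y)
    (hxw : Γ.dist x w < Γ.dist v w) (hyw : Γ.dist y w < Γ.dist v w) : x = y := by
  by_contra hxy
  have h2 := hΓ.dist_eq_two hx hy hxy
  have hvx : Γ.dist x v = 1 := dist_eq_one_iff_adj.2 hx.symm
  have hvy : Γ.dist v y = 1 := dist_eq_one_iff_adj.2 hy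
  have hy' := hΓ.dist_adj_cases' w hy
  have := hΓ.dist_eq_of_overlap (x := x) (y := v) (z := y) (w := w) (by omega) (by omega) hy.ne
  omega

/-- The only edge joining the two sides of the edge `ab` is `ab` itself. -/
theorem eq_of_separated (hΓ : Γ.IsTree) {a b c d : V} (hab : Γ.Adj a b) (hcd : Γ.Adj c d)
    (hc : Γ.dist b c < Γ.dist a c) (hd : ¬ Γ.dist b d < Γ.dist a d) : c = b ∧ d = a := by
  have h1 := hΓ.dist_adj_cases' c hab
  have h2 := hΓ.dist_adj_cases' d hab
  have hba : Γ.dist b a = 1 := dist_eq_one_iff_adj.2 hab.symm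
  have hcd : Γ.dist c d = 1 := dist_eq_one_iff_adj.2 hcd
  have e1 : Γ.dist c b = Γ.dist b c := dist_comm
  have e2 : Γ.dist c a = Γ.dist a c := dist_comm
  have := hΓ.dist_eq_of_overlap (x := c) (y := b) (z := a) (w := d) (by omega) (by omega)
    hab.ne.symm
  constructor
  · exact (hΓ.connected.dist_eq_zero_iff).1 (by omega)
  · exact ((hΓ.connected.dist_eq_zero_iff (u := a)).1 (by omega)).symm

/-- A nonempty convex set of vertices of a tree is connected. -/
theorem connected_induce (hΓ : Γ.IsTree)
    (S : Set V) (hne : S.Nonempty)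
    (hS : ∀ x ∈ S, ∀ y ∈ S, ∀ w, Γ.Adj x w → Γ.dist w y + 1 = Γ.dist x y → w ∈ S) :
    (Γ.induce S).Connected := by
  have key : ∀ (k : ℕ) (x y : V) (hx : x ∈ S) (hy : y ∈ S), Γ.dist x y = k →
      (Γ.induce S).Reachable ⟨x, hx⟩ ⟨y, hy⟩ := by
    intro k
    induction k with
    | zero =>
      intro x y hx hy h
      obtain rfl := hΓ.connected.dist_eq_zero_iff.1 h
      exact Reachable.refl _
    | succ k ih =>
      intro x y hx hy h
      have hxy : x ≠ y := by rintro rfl; simp at h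
      obtain ⟨w, hw, hwd⟩ := hΓ.exists_adj_closer hxy
      have hadj : (Γ.induce S).Adj ⟨x, hx⟩ ⟨w, hS x hx y hy w hw hwd⟩ := hw
      exact hadj.reachable.trans (ih w y _ hy (by omega))
  obtain ⟨x, hx⟩ := hne
  rw [connected_iff]
  exact ⟨fun ⟨x, hx⟩ ⟨y, hy⟩ => key _ x y hx hy rfl, ⟨⟨x, hx⟩⟩⟩

end SimpleGraph.IsTree

end

/-! ### Translations of trees, and normal cyclic groups generated by a translation -/

noncomputable section

open scoped commutatorElement

namespace GTree

variable {G : Type u} [Group G]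

theorem dist_smul (T : GTree.{u, v} G) (g : G) (a b : T.V) :
    T.graph.dist (g • a) (g • b) = T.graph.dist a b := by
  have key : ∀ (g : G) (a b : T.V), T.graph.dist (g • a) (g • b) ≤ T.graph.dist a b := by
    intro g a b
    obtain ⟨p, hp⟩ := T.isTree.connected.exists_walk_length_eq_dist a b
    let φ : T.graph →g T.graph := ⟨fun x => g • x, fun {x y} h => T.adj_smul g x y h⟩
    have := SimpleGraph.dist_le (p.map φ)
    rw [SimpleGraph.Walk.length_map, hp] at this
    exact this
  refine le_antisymm (key g a b) ?_
  simpa using key g⁻¹ (g • a) (g • b)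

theorem dist_smul_left (T : GTree.{u, v} G) (g : G) (a b : T.V) :
    T.graph.dist (g • a) b = T.graph.dist a (g⁻¹ • b) := by
  rw [← T.dist_smul g⁻¹, inv_smul_smul]

/-- A fixed-point-free element acts as a translation of positive length `ℓ`. -/
theorem exists_translation (T : GTree.{u, v} G) (a : G) (ha : ∀ x : T.V, a • x ≠ x) :
    ∃ ℓ : ℕ, 0 < ℓ ∧ (∃ x : T.V, ∀ n : ℕ, T.graph.dist x (a ^ n • x) = n * ℓ) ∧
      ∀ (x : T.V) (n : ℕ), n * ℓ ≤ T.graph.dist x (a ^ n • x) := by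
  have hT := T.isTree
  have hc := hT.connected
  have : Nonempty T.V := hc.nonempty
  obtain ⟨x, hx⟩ : ∃ x : T.V, ∀ y, T.graph.dist x (a • x) ≤ T.graph.dist y (a • y) :=
    ⟨Function.argmin (fun x : T.V => T.graph.dist x (a • x)),
      fun y => Function.argmin_le (fun x : T.V => T.graph.dist x (a • x)) y⟩
  set ℓ := T.graph.dist x (a • x) with hℓ
  have hpos : 0 < ℓ := hc.pos_dist_of_ne (ha x).symm
  -- Let `y` and `z` be the neighbours of `a • x` towards `x` and `a • a • x`. If they agree, then
  -- either ℓ > 1 and `y` is displaced by only ℓ - 2, against the choice of `x`, or ℓ = 1 and `a`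
  -- inverts an edge. If they differ, there is no backtracking at `a • x` and the two geodesics
  -- concatenate.
  have h2 : T.graph.dist x (a • a • x) = 2 * ℓ := by
    obtain ⟨y, hy, hyd⟩ := hT.exists_adj_closer (v := a • x) (w := x) (ha x)
    obtain ⟨z, hz, hzd⟩ := hT.exists_adj_closer (v := a • x) (w := a • a • x)
      (by rw [Ne, smul_left_cancel_iff]; exact (ha x).symm)
    rw [T.dist_smul] at hzd
    rw [SimpleGraph.dist_comm (u := a • x), ← hℓ] at hyd
    rw [← hℓ] at hzd
    have h1y : T.graph.dist y (a • x) = 1 := SimpleGraph.dist_eq_one_iff_adj.2 hy.symm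
    have h1z : T.graph.dist (a • x) z = 1 := SimpleGraph.dist_eq_one_iff_adj.2 hz
    rw [SimpleGraph.dist_comm] at hyd
    by_cases hyz : y = z
    · subst hyz
      exfalso
      have h3 : T.graph.dist (a • y) (a • a • x) = 1 := by rw [T.dist_smul, h1y]
      rcases Nat.lt_or_ge 1 ℓ with hl | hl
      · have h4 : a • a • x ≠ y := by
          intro h
          rw [h, SimpleGraph.dist_self] at hzd
          omega
        have hay : T.graph.Adj (a • y) (a • a • x) := SimpleGraph.dist_eq_one_iff_adj.1 h3
        have h5 := hx y
        obtain ⟨w, hw, hwd⟩ := hT.exists_adj_closer (v := a • a • x) (w := y) h4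
        have hwe : w = a • y := by
          refine hT.eq_of_adj_closer (w := a • x) hw hay.symm ?_ ?_
          · have e1 := hc.dist_triangle (u := w) (v := y) (w := a • x)
            rw [SimpleGraph.dist_comm (u := a • a • x) (v := y)] at hwd
            rw [T.dist_smul, SimpleGraph.dist_comm (u := a • x) (v := x), ← hℓ]
            have e2 := hT.dist_adj_cases' (a • x) hw
            rw [T.dist_smul, SimpleGraph.dist_comm (u := a • x) (v := x), ← hℓ] at e2
            omega
          · rw [T.dist_smul, T.dist_smul, SimpleGraph.dist_comm (u := a • x) (v := x), ← hℓ,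
              SimpleGraph.dist_comm]
            omega
        subst hwe
        rw [SimpleGraph.dist_comm (u := a • a • x) (v := y),
          SimpleGraph.dist_comm (u := a • y)] at hwd
        omega
      · have hy0 : x = y := hc.dist_eq_zero_iff.1 (by omega)
        have hz0 : y = a • a • x := hc.dist_eq_zero_iff.1 (by omega)
        exact T.no_inversion a x (a • x) (SimpleGraph.dist_eq_one_iff_adj.1 (by omega))
          ⟨rfl, by rw [← hz0, hy0]⟩
    · have h3 := hT.dist_eq_two hy hz hyz
      have h4 := hT.dist_eq_of_overlap (x := x) (y := y) (z := a • x) (w := z)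
        (by omega) (by omega) hy.ne.symm
      have h5 := hT.dist_eq_of_overlap (x := x) (y := a • x) (z := z) (w := a • a • x)
        (by omega) (by rw [T.dist_smul]; omega) hz.ne
      omega
  have hn : ∀ n : ℕ, T.graph.dist x (a ^ n • x) = n * ℓ ∧
      T.graph.dist x (a ^ (n + 1) • x) = (n + 1) * ℓ := by
    intro n
    induction n with
    | zero => simp [hℓ]
    | succ n ih =>
      refine ⟨ih.2, ?_⟩
      have e0 : a ^ (n + 1) • x = a ^ n • a • x := by rw [pow_succ, mul_smul]
      have e1 : a ^ (n + 1 + 1) • x = a ^ n • a • a • x := by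
        rw [pow_succ, pow_succ, mul_smul, mul_smul]
      have := hT.dist_eq_of_overlap (x := x) (y := a ^ n • x) (z := a ^ (n + 1) • x)
        (w := a ^ (n + 1 + 1) • x)
        (by rw [ih.1, ih.2, e0, T.dist_smul]; ring)
        (by rw [e0, e1, T.dist_smul, T.dist_smul, T.dist_smul, T.dist_smul, h2]; ring)
        (by rw [e0, Ne, smul_left_cancel_iff]; exact (ha x).symm)
      rw [this, e0, e1, T.dist_smul, T.dist_smul, T.dist_smul, ih.1]
      ring
  refine ⟨ℓ, hpos, ⟨x, fun n => (hn n).1⟩, ?_⟩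
  intro y n
  have hk : ∀ k : ℕ, T.graph.dist y ((a ^ n) ^ k • y) ≤ k * T.graph.dist y (a ^ n • y) := by
    intro k
    induction k with
    | zero => simp
    | succ k ih =>
      have := hc.dist_triangle (u := y) (v := (a ^ n) ^ k • y) (w := (a ^ n) ^ (k + 1) • y)
      rw [pow_succ (a ^ n), mul_smul, T.dist_smul] at this
      rw [pow_succ (a ^ n), mul_smul]
      linarith
  by_contra hlt
  push Not at hlt
  set D := T.graph.dist x y
  -- If `a ^ n` moved `y` by less than n ℓ, each iterate would save at least 1. Passing from `y` to
  -- `x` costs at most 2 D in total, so 2 D + 1 iterates give a contradiction.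
  have h1 := hk (2 * D + 1)
  have h3 := hc.dist_triangle (u := x) (v := y) (w := (a ^ n) ^ (2 * D + 1) • x)
  have h4 := hc.dist_triangle (u := y) (v := (a ^ n) ^ (2 * D + 1) • y)
    (w := (a ^ n) ^ (2 * D + 1) • x)
  rw [T.dist_smul, SimpleGraph.dist_comm (u := y) (v := x)] at h4
  rw [← pow_mul, (hn _).1] at h3
  rw [← pow_mul] at h4 h1
  have h6 : (2 * D + 1) * (T.graph.dist y (a ^ n • y) + 1) ≤ (2 * D + 1) * (n * ℓ) :=
    Nat.mul_le_mul_left _ hlt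
  have h7 : n * (2 * D + 1) * ℓ ≤ D + ((2 * D + 1) * T.graph.dist y (a ^ n • y) + D) := by
    refine h3.trans (Nat.add_le_add_left (h4.trans (Nat.add_le_add_right h1 _)) _)
  nlinarith

/-- A root of an elliptic element is elliptic. -/
theorem exists_fixed_of_pow (T : GTree.{u, v} G) (b : G) (n : ℕ) (hn : 0 < n) (x : T.V)
    (hx : b ^ n • x = x) : ∃ y : T.V, b • y = y := by
  by_contra! h
  obtain ⟨ℓ, hℓ, -, hd⟩ := T.exists_translation b h
  have := hd x n
  rw [hx, SimpleGraph.dist_self] at this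
  have := Nat.mul_pos hn hℓ
  omega

/-- The set of vertices moved the least by a translation is connected. -/
theorem connected_minSet (T : GTree.{u, v} G) (z : G) (ℓ : ℕ) (hℓ : 0 < ℓ)
    (hmin : ∀ x : T.V, ℓ ≤ T.graph.dist x (z • x)) (hne : ∃ x : T.V, T.graph.dist x (z • x) = ℓ) :
    (T.graph.induce {x : T.V | T.graph.dist x (z • x) = ℓ}).Connected := by
  have hT := T.isTree
  have hc := hT.connected
  refine hT.connected_induce _ hne fun x hx y hy w hw hwd => ?_
  simp only [Set.mem_ofPred_eq] at hx hy ⊢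
  have hxy : 0 < T.graph.dist x y := by omega
  have hwx : T.graph.dist w x = 1 := SimpleGraph.dist_eq_one_iff_adj.2 hw.symm
  have hzw : T.graph.dist (z • x) (z • w) = 1 := by
    rw [T.dist_smul]; exact SimpleGraph.dist_eq_one_iff_adj.2 hw
  have hzadj := SimpleGraph.dist_eq_one_iff_adj.1 hzw
  refine le_antisymm ?_ (hmin w)
  rcases hT.dist_adj_cases' (z • x) hw with h1 | h1
  · rcases hT.dist_adj_cases x hzadj with h2 | h2
    -- Here `w` points away from `z • x` and `z • w` points away from `x`, so the path from `y`
    -- through `w`, `x`, `z • x`, `z • w` to `z • y` is geodesic and `y` is moved by more than ℓ.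
    · exfalso
      have hyw : T.graph.dist y x = T.graph.dist y w + T.graph.dist w x := by
        rw [SimpleGraph.dist_comm, SimpleGraph.dist_comm (u := y), hwx]; omega
      have h3 := hT.dist_eq_of_overlap (x := y) (y := w) (z := x) (w := z • x) hyw
        (by omega) hw.ne.symm
      have h4 := hT.dist_eq_of_overlap (x := x) (y := z • x) (z := z • w) (w := z • y)
        (by omega) (by rw [T.dist_smul, T.dist_smul, T.dist_smul,
          SimpleGraph.dist_comm (u := x) (v := w)]; omega) hzadj.ne
      have hxzx : x ≠ z • x := by
        intro h5; rw [← h5, SimpleGraph.dist_self] at hx; omega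
      have hyx := SimpleGraph.dist_comm (G := T.graph) (u := y) (v := x)
      rw [T.dist_smul, T.dist_smul, SimpleGraph.dist_comm (u := x) (v := w)] at h4
      have h5 := hT.dist_eq_of_overlap (x := y) (y := x) (z := z • x) (w := z • y)
        (by omega) (by rw [T.dist_smul]; omega) hxzx
      rw [T.dist_smul] at h5
      omega
    · have := hc.dist_triangle (u := w) (v := x) (w := z • w)
      omega
  · have := hc.dist_triangle (u := w) (v := z • x) (w := z • w)
    omega

/-- If a cyclic group generated by a translation is normal, then the group acts on a line with
cyclic stabilizers, and so it is solvable. -/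
theorem isSolvable_of_normal_translation (T : GTree.{u, v} G) (hmin : T.IsMinimal)
    (hcyc : ∀ x : T.V, IsCyclic (MulAction.stabilizer G x)) (z : G)
    (hz : ∀ x : T.V, z • x ≠ x) (hnorm : ∀ g : G, g * z * g⁻¹ = z ∨ g * z * g⁻¹ = z⁻¹) :
    Group.IsSolvable G := by
  have hT := T.isTree
  have hc := hT.connected
  obtain ⟨ℓ, hℓ, ⟨x₀, hx₀⟩, hle⟩ := T.exists_translation z hz
  have hx₁ : T.graph.dist x₀ (z • x₀) = ℓ := by simpa using hx₀ 1
  have hle1 : ∀ x : T.V, ℓ ≤ T.graph.dist x (z • x) := fun x => by simpa using hle x 1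
  have hinv : ∀ x : T.V, T.graph.dist x (z⁻¹ • x) = T.graph.dist x (z • x) := by
    intro x
    rw [SimpleGraph.dist_comm, T.dist_smul_left, inv_inv]
  have hS := hmin {x : T.V | T.graph.dist x (z • x) = ℓ} (by
    intro g x hx
    simp only [Set.mem_ofPred_eq] at hx ⊢
    rw [T.dist_smul_left, ← mul_smul, ← mul_smul]
    have h1 := hnorm g⁻¹
    rw [inv_inv] at h1
    rcases h1 with h1 | h1
    · rw [h1, hx]
    · rw [h1, hinv, hx]) (T.connected_minSet z ℓ hℓ hle1 ⟨x₀, hx₁⟩)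
  have hd : ∀ x : T.V, T.graph.dist x (z • x) = ℓ := fun x => by
    have : x ∈ {x : T.V | T.graph.dist x (z • x) = ℓ} := hS ▸ Set.mem_univ x
    exact this
  have hd2 : ∀ x : T.V, 2 * ℓ ≤ T.graph.dist (z⁻¹ • x) (z • x) := fun x => by
    rw [T.dist_smul_left, inv_inv, ← mul_smul, ← pow_two]
    exact hle x 2
  have hnxt : ∀ x : T.V, ∃ y, T.graph.Adj x y ∧ T.graph.dist y (z • x) + 1 = ℓ := fun x => by
    obtain ⟨y, hy, h⟩ := hT.exists_adj_closer (hz x).symm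
    exact ⟨y, hy, by rw [h, hd]⟩
  have hprv : ∀ x : T.V, ∃ y, T.graph.Adj x y ∧ T.graph.dist y (z⁻¹ • x) + 1 = ℓ := fun x => by
    obtain ⟨y, hy, h⟩ := hT.exists_adj_closer (v := x) (w := z⁻¹ • x)
      (fun h => hz x (by rw [h, smul_inv_smul, ← h]))
    exact ⟨y, hy, by rw [h, hinv, hd]⟩
  choose nxt hnxt hnxtd using hnxt
  choose prv hprv hprvd using hprv
  have nxt_eq : ∀ x y, T.graph.Adj x y → T.graph.dist y (z • x) < ℓ → y = nxt x := by
    intro x y hxy h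
    refine hT.eq_of_adj_closer hxy (hnxt x) (w := z • x) (by rw [hd]; exact h) ?_
    rw [hd]; have := hnxtd x; omega
  have prv_eq : ∀ x y, T.graph.Adj x y → T.graph.dist y (z⁻¹ • x) < ℓ → y = prv x := by
    intro x y hxy h
    refine hT.eq_of_adj_closer hxy (hprv x) (w := z⁻¹ • x) (by rw [hinv, hd]; exact h) ?_
    rw [hinv, hd]; have := hprvd x; omega
  have hne : ∀ x, nxt x ≠ prv x := by
    intro x h
    have h1 := hnxtd x
    have h2 := hprvd x
    have h3 := hc.dist_triangle (u := z⁻¹ • x) (v := nxt x) (w := z • x)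
    rw [SimpleGraph.dist_comm (u := z⁻¹ • x) (v := nxt x), h] at h3
    rw [h] at h1
    have := hd2 x
    omega
  -- A third neighbour would branch off the axis and be moved by ℓ + 2, although every vertex is
  -- moved by exactly ℓ. So the tree is a line, with `nxt` as its shift.
  have hadj : ∀ x y, T.graph.Adj x y → y = nxt x ∨ y = prv x := by
    intro x y hxy
    by_contra hcon
    push Not at hcon
    have h1 : ¬ T.graph.dist y (z • x) < ℓ := fun h => hcon.1 (nxt_eq x y hxy h)
    have h2 : ¬ T.graph.dist y (z⁻¹ • x) < ℓ := fun h => hcon.2 (prv_eq x y hxy h)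
    have h3 := hT.dist_adj_cases' (z • x) hxy
    rw [hd] at h3
    have h4 : T.graph.dist x (z • y) = T.graph.dist y (z⁻¹ • x) := by
      rw [SimpleGraph.dist_comm, T.dist_smul_left]
    have h5 := hT.dist_adj_cases' (z⁻¹ • x) hxy
    rw [hinv, hd] at h5
    have h6 : T.graph.dist y x = 1 := SimpleGraph.dist_eq_one_iff_adj.2 hxy.symm
    have h7 : T.graph.dist (z • x) (z • y) = 1 := by
      rw [T.dist_smul]; exact SimpleGraph.dist_eq_one_iff_adj.2 hxy
    have h8 := hd x
    have := hT.dist_eq_of_overlap (x := y) (y := x) (z := z • x) (w := z • y)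
      (by omega) (by omega) (hz x).symm
    rw [hd] at this
    omega
  have hprvnxt : ∀ x, prv (nxt x) = x := by
    intro x
    symm
    refine prv_eq _ _ (hnxt x).symm ?_
    have h1 := hnxtd x
    rw [SimpleGraph.dist_comm, T.dist_smul_left, inv_inv]
    omega
  have hnxtprv : ∀ x, nxt (prv x) = x := by
    intro x
    symm
    refine nxt_eq _ _ (hprv x).symm ?_
    have h1 := hprvd x
    rw [SimpleGraph.dist_comm, T.dist_smul_left]
    omega
  let σ : Equiv.Perm T.V := ⟨nxt, prv, hprvnxt, hnxtprv⟩
  have hσ : ∀ (h : G), h * z = z * h → ∀ x, h • σ x = σ (h • x) := by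
    intro h hh x
    refine nxt_eq _ _ (T.adj_smul h _ _ (hnxt x)) ?_
    rw [← mul_smul, ← hh, mul_smul, T.dist_smul]
    have : T.graph.dist (σ x) (z • x) + 1 = ℓ := hnxtd x
    omega
  have horb : ∀ y, ∃ k : ℤ, (σ ^ k) x₀ = y := by
    intro y
    obtain ⟨p⟩ := hc.preconnected y x₀
    induction p with
    | nil => exact ⟨0, rfl⟩
    | @cons a b c hab p ih =>
      obtain ⟨k, hk⟩ := ih hx₀ hx₁
      rcases hadj b a hab.symm with h | h
      · refine ⟨1 + k, ?_⟩
        rw [zpow_add, zpow_one, Equiv.Perm.mul_apply, hk, h]; rfl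
      · refine ⟨-1 + k, ?_⟩
        rw [zpow_add, zpow_neg_one, Equiv.Perm.mul_apply, hk, h]; rfl
  have hσk : ∀ (h : G), h * z = z * h → ∀ (k : ℤ) x, h • (σ ^ k) x = (σ ^ k) (h • x) := by
    intro h hh k x
    let τ : Equiv.Perm T.V := MulAction.toPerm h
    have hcomm : Commute τ σ := Equiv.ext fun x => hσ h hh x
    have := congrArg (fun e : Equiv.Perm T.V => e x) (hcomm.zpow_right k).eq
    exact this
  let C : Subgroup G := Subgroup.centralizer {z}
  have hC : ∀ h, h ∈ C ↔ h * z = z * h := fun h => by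
    rw [Subgroup.mem_centralizer_singleton_iff]
  -- Conjugation acts on `z` only through sign changes, and these commute.
  have step1 : ⁅(⊤ : Subgroup G), (⊤ : Subgroup G)⁆ ≤ C := by
    rw [Subgroup.commutator_le]
    intro g _ h _
    rw [hC]
    have hA : ∀ g, MulAut.conj g z = z ∨ MulAut.conj g z = z⁻¹ := hnorm
    have : MulAut.conj ⁅g, h⁆ z = z := by
      have e : MulAut.conj g (MulAut.conj h z) = MulAut.conj h (MulAut.conj g z) := by
        rcases hA g with h1 | h1 <;> rcases hA h with h2 | h2 <;>
          simp only [h1, h2, map_inv, inv_inv]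
      rw [commutatorElement_def, map_mul, map_mul, map_mul, map_inv, map_inv]
      simp only [MulAut.mul_apply]
      have e' : (MulAut.conj g)⁻¹ ((MulAut.conj h)⁻¹ z) = (MulAut.conj h * MulAut.conj g)⁻¹ z := by
        rw [mul_inv_rev]; rfl
      rw [e', ← MulAut.mul_apply, ← MulAut.mul_apply]
      have hg : ∀ g, (MulAut.conj g)⁻¹ z = z ∨ (MulAut.conj g)⁻¹ z = z⁻¹ := by
        intro g; rw [← map_inv]; exact hA _
      have e'' : (MulAut.conj h * MulAut.conj g)⁻¹ z = (MulAut.conj g * MulAut.conj h)⁻¹ z := by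
        rw [mul_inv_rev, mul_inv_rev, MulAut.mul_apply, MulAut.mul_apply]
        rcases hg g with h1 | h1 <;> rcases hg h with h2 | h2 <;>
          simp only [h1, h2, map_inv, inv_inv]
      rw [MulAut.mul_apply, e'', MulAut.apply_inv_self]
    rw [MulAut.conj_apply, mul_inv_eq_iff_eq_mul] at this
    exact this
  -- An element centralizing `z` commutes with the shift `σ`, and `x₀` generates the line under `σ`.
  -- Hence it acts as a power of `σ`, and such powers commute.
  have step2 : ⁅C, C⁆ ≤ MulAction.stabilizer G x₀ := by
    rw [Subgroup.commutator_le]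
    intro g hg h hh
    rw [hC] at hg hh
    rw [MulAction.mem_stabilizer_iff]
    have key : (g * h) • x₀ = (h * g) • x₀ := by
      obtain ⟨i, hi⟩ := horb (g • x₀)
      obtain ⟨j, hj⟩ := horb (h • x₀)
      rw [mul_smul, mul_smul, ← hi, ← hj, hσk g hg, hσk h hh, ← hi, ← hj, ← Equiv.Perm.mul_apply,
        ← Equiv.Perm.mul_apply, ← zpow_add, ← zpow_add, add_comm]
    have hcomm : ⁅g, h⁆ * (h * g) = g * h := by rw [commutatorElement_def]; group
    have hgC : (h * g) * z = z * (h * g) := by rw [mul_assoc, hg, ← mul_assoc, hh, mul_assoc]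
    have hgC' : (g * h) * z = z * (g * h) := by rw [mul_assoc, hh, ← mul_assoc, hg, mul_assoc]
    obtain ⟨k, hk⟩ := horb ((h * g)⁻¹ • x₀)
    have hinvC : (h * g)⁻¹ * z = z * (h * g)⁻¹ := (Commute.inv_left (show Commute (h*g) z from hgC)).eq
    have e : ⁅g, h⁆ = (g * h) * (h * g)⁻¹ := by rw [commutatorElement_def]; group
    rw [e, mul_smul, ← hk, hσk _ hgC', key, ← hσk _ hgC, hk, smul_inv_smul]
  have step3 : ⁅MulAction.stabilizer G x₀, MulAction.stabilizer G x₀⁆ ≤ (⊥ : Subgroup G) := by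
    rw [Subgroup.commutator_le]
    intro g hg h hh
    have := hcyc x₀
    let _ := IsCyclic.commGroup (α := MulAction.stabilizer G x₀)
    have := congrArg Subtype.val
      (mul_comm (⟨g, hg⟩ : MulAction.stabilizer G x₀) ⟨h, hh⟩)
    rw [Subgroup.mem_bot, commutatorElement_eq_one_iff_mul_comm]
    exact this
  refine ⟨⟨3, ?_⟩⟩
  rw [eq_bot_iff]
  refine le_trans (Subgroup.commutator_mono ?_ ?_) step3 <;>
  exact (Subgroup.commutator_mono step1 step1).trans step2

end GTree

end

/-! ### Commensurated elements of GBS groups -/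

noncomputable section

namespace SimpleGraph.IsTree

variable {V A : Type*} {Γ : SimpleGraph V} [Group A]

/-- The product of the labels of the darts of a walk. -/
def walkLabel (w : V → V → A) : {x y : V} → Γ.Walk x y → A
  | _, _, Walk.nil => 1
  | x, _, @Walk.cons _ _ _ y _ _ p => w x y * walkLabel w p

theorem walkLabel_concat (w : V → V → A) {x y z : V} (p : Γ.Walk x y) (h : Γ.Adj y z) :
    walkLabel w (p.concat h) = walkLabel w p * w y z := by
  induction p with
  | nil => simp [Walk.concat_nil, walkLabel]
  | cons h' p ih => rw [Walk.concat_cons, walkLabel, walkLabel, ih, mul_assoc]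

/-- On a tree every labelling of the darts comes from a potential. -/
theorem exists_potential (hΓ : Γ.IsTree) (w : V → V → A)
    (hw : ∀ x y, Γ.Adj x y → w x y * w y x = 1) :
    ∃ r : V → A, ∀ x y, Γ.Adj x y → r y = r x * w x y := by
  obtain ⟨x₀⟩ := hΓ.connected.nonempty
  choose P hP hP' using fun y => hΓ.existsUnique_path x₀ y
  refine ⟨fun y => walkLabel w (P y), fun x y hxy => ?_⟩
  -- The potential at `y` is the label of the path from `x₀` to `y`. Of the paths to two adjacent
  -- vertices, one extends the other by the edge between them.
  by_cases h : x ∈ (P y).support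
  · simp only
    rw [hΓ.isAcyclic.path_concat (hP x) (hP y) hxy h, walkLabel_concat]
  · have hy := hΓ.isAcyclic.mem_support_of_ne_mem_support_of_adj_of_isPath (hP x) (hP y) hxy h
    simp only
    rw [hΓ.isAcyclic.path_concat (hP y) (hP x) hxy.symm hy, walkLabel_concat, mul_assoc,
      hw y x hxy.symm, mul_one]

end SimpleGraph.IsTree

namespace GraphOfGroups

variable (Γ : GraphOfGroups)

/-- On the maximal subtree, labels of the edges come from a potential. -/
theorem IsMaximalSubtree.exists_potential {Γ : GraphOfGroups} {τ : Set Γ.E}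
    (hτ : Γ.IsMaximalSubtree τ) {A : Type*} [Group A] (c : Γ.E → A) :
    ∃ r : Γ.V → A, ∀ e ∈ τ, r (Γ.t e) = r (Γ.o e) * c e := by
  classical
  obtain ⟨hloop, hinj, htree⟩ := hτ
  let w : Γ.V → Γ.V → A := fun x y =>
    if h : ∃ e ∈ τ, Γ.o e = x ∧ Γ.t e = y then c h.choose else
      if h : ∃ e ∈ τ, Γ.o e = y ∧ Γ.t e = x then (c h.choose)⁻¹ else 1
  have hw1 : ∀ e ∈ τ, w (Γ.o e) (Γ.t e) = c e := by
    intro e he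
    have h : ∃ e' ∈ τ, Γ.o e' = Γ.o e ∧ Γ.t e' = Γ.t e := ⟨e, he, rfl, rfl⟩
    have h2 : h.choose = e := by
      obtain ⟨h3, h4, h5⟩ := h.choose_spec
      refine hinj h3 he ?_
      simp only [h4, h5]
    simp only [w, dif_pos h, h2]
  have hw2 : ∀ e ∈ τ, w (Γ.t e) (Γ.o e) = (c e)⁻¹ := by
    intro e he
    have h0 : ¬ ∃ e' ∈ τ, Γ.o e' = Γ.t e ∧ Γ.t e' = Γ.o e := by
      rintro ⟨e', he', h1, h2⟩
      have : e' = e := hinj he' he (by simp only [h1, h2, Sym2.eq_swap])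
      subst this
      exact hloop _ he h1
    have h : ∃ e' ∈ τ, Γ.o e' = Γ.o e ∧ Γ.t e' = Γ.t e := ⟨e, he, rfl, rfl⟩
    have h2 : h.choose = e := by
      obtain ⟨h3, h4, h5⟩ := h.choose_spec
      refine hinj h3 he ?_
      simp only [h4, h5]
    simp only [w, dif_neg h0, dif_pos h, h2]
  obtain ⟨r, hr⟩ := htree.exists_potential w (by
    intro x y hxy
    rw [SimpleGraph.fromEdgeSet_adj] at hxy
    obtain ⟨⟨e, he, hexy⟩, -⟩ := hxy
    simp only [Sym2.eq_iff] at hexy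
    rcases hexy with ⟨rfl, rfl⟩ | ⟨rfl, rfl⟩
    · rw [hw1 e he, hw2 e he, mul_inv_cancel]
    · rw [hw1 e he, hw2 e he, inv_mul_cancel])
  refine ⟨r, fun e he => ?_⟩
  rw [hr _ _ _, hw1 e he]
  rw [SimpleGraph.fromEdgeSet_adj]
  exact ⟨⟨e, he, rfl⟩, hloop e he⟩

variable (τ : Set Γ.E)

/-- The canonical map from a vertex group to the fundamental group. -/
def vertexHom (v : Γ.V) : Γ.Gv v →* Γ.FundamentalGroup τ :=
  MonoidHom.mk' (fun g => PresentedGroup.of (Sum.inl ⟨v, g⟩)) (fun g h => by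
    have := PresentedGroup.one_of_mem (rels := {r | Γ.Rel τ r}) (Rel.vertex v g h)
    rw [map_mul, map_mul, map_inv, mul_inv_eq_one] at this
    exact this.symm)

/-- The element of the fundamental group given by an edge. -/
def edgeElt (e : Γ.E) : Γ.FundamentalGroup τ := PresentedGroup.of (Sum.inr e)

theorem edge_rel (e : Γ.E) (h : Γ.Ge e) :
    Γ.edgeElt τ e * Γ.vertexHom τ (Γ.t e) (Γ.ιt e h) * (Γ.edgeElt τ e)⁻¹ =
      Γ.vertexHom τ (Γ.o e) (Γ.ιo e h) := by
  have := PresentedGroup.one_of_mem (rels := {r | Γ.Rel τ r}) (Rel.edge e h)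
  rw [map_mul, map_mul, map_mul, map_inv, map_inv, mul_inv_eq_one] at this
  exact this

theorem edgeElt_eq_one {e : Γ.E} (he : e ∈ τ) : Γ.edgeElt τ e = 1 :=
  PresentedGroup.one_of_mem (rels := {r | Γ.Rel τ r}) (Rel.tree e he)

end GraphOfGroups

/-- The elements `g` such that conjugation by `g` takes some nonzero power of `a` to a nonzero
power of `a`. -/
def powerCommensurator {G : Type*} [Group G] (a : G) : Subgroup G where
  carrier := {g | ∃ p q : ℤ, p ≠ 0 ∧ q ≠ 0 ∧ g * a ^ p * g⁻¹ = a ^ q}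
  one_mem' := ⟨1, 1, one_ne_zero, one_ne_zero, by simp⟩
  mul_mem' := by
    rintro g h ⟨p, q, hp, hq, hg⟩ ⟨r, s, hr, hs, hh⟩
    refine ⟨r * p, q * s, mul_ne_zero hr hp, mul_ne_zero hq hs, ?_⟩
    have e1 : h * a ^ (r * p) * h⁻¹ = a ^ (s * p) := by
      rw [zpow_mul, ← conj_zpow, hh, ← zpow_mul]
    have e2 : g * a ^ (s * p) * g⁻¹ = a ^ (q * s) := by
      rw [mul_comm s, zpow_mul, ← conj_zpow, hg, ← zpow_mul]
    rw [← e2, ← e1]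
    group
  inv_mem' := by
    rintro g ⟨p, q, hp, hq, hg⟩
    refine ⟨q, p, hq, hp, ?_⟩
    rw [← hg]
    group

theorem addRight_mul_addRight (r s : ℚ) :
    (Equiv.addRight r * Equiv.addRight s : Equiv.Perm ℚ) = Equiv.addRight (r + s) := by
  ext x
  simp [add_assoc, add_comm r s]

/-- A generalized Baumslag-Solitar group is finitely generated, and it contains an element of
infinite order whose commensurator is the whole group. -/
theorem IsGBS.fg_and_exists_commensurated {G : Type u} [Group G] (hG : IsGBS G) :
    Group.FG G ∧ ∃ a : G, (∀ n : ℤ, n ≠ 0 → a ^ n ≠ 1) ∧ powerCommensurator a = ⊤ := by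
  obtain ⟨Γ, τ, hV, hE, hv, he, hτ, ⟨φ⟩⟩ := hG
  have := fun v => (hv v).1
  have := fun v => (hv v).2
  have := fun e => (he e).1
  have := fun e => (he e).2
  let L : ∀ v, Γ.Gv v ≃* Multiplicative ℤ := fun v => intCyclicMulEquiv.symm
  let Le : ∀ e, Γ.Ge e ≃* Multiplicative ℤ := fun e => intCyclicMulEquiv.symm
  let γ : ∀ v, Γ.Gv v := fun v => (L v).symm (Multiplicative.ofAdd 1)
  let η : ∀ e, Γ.Ge e := fun e => (Le e).symm (Multiplicative.ofAdd 1)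
  have hγ : ∀ v g, g = γ v ^ (Multiplicative.toAdd (L v g)) := by
    intro v g
    apply (L v).injective
    simp only [γ, map_zpow, MulEquiv.apply_symm_apply, ← ofAdd_zsmul, smul_eq_mul, mul_one,
      ofAdd_toAdd]
  have hη : ∀ e g, g = η e ^ (Multiplicative.toAdd (Le e g)) := by
    intro e g
    apply (Le e).injective
    simp only [η, map_zpow, MulEquiv.apply_symm_apply, ← ofAdd_zsmul, smul_eq_mul, mul_one,
      ofAdd_toAdd]
  have hη1 : ∀ e, η e ≠ 1 := by
    intro e h
    have := congrArg (Le e) h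
    simp only [η, map_one, MulEquiv.apply_symm_apply] at this
    have h2 : (1 : ℤ) = 0 := this
    exact one_ne_zero h2
  let p : Γ.E → ℤ := fun e => Multiplicative.toAdd (L (Γ.o e) (Γ.ιo e (η e)))
  let q : Γ.E → ℤ := fun e => Multiplicative.toAdd (L (Γ.t e) (Γ.ιt e (η e)))
  have hp : ∀ e, p e ≠ 0 := by
    intro e h
    have h1 : L (Γ.o e) (Γ.ιo e (η e)) = 1 := h
    rw [map_eq_one_iff _ (L _).injective, map_eq_one_iff _ (Γ.ιo_injective e)] at h1
    exact hη1 e h1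
  have hq : ∀ e, q e ≠ 0 := by
    intro e h
    have h1 : L (Γ.t e) (Γ.ιt e (η e)) = 1 := h
    rw [map_eq_one_iff _ (L _).injective, map_eq_one_iff _ (Γ.ιt_injective e)] at h1
    exact hη1 e h1
  have hιo : ∀ e, Γ.ιo e (η e) = γ (Γ.o e) ^ p e := fun e => hγ _ _
  have hιt : ∀ e, Γ.ιt e (η e) = γ (Γ.t e) ^ q e := fun e => hγ _ _
  let A : ∀ v, Γ.FundamentalGroup τ := fun v => Γ.vertexHom τ v (γ v)
  have hrel : ∀ e, Γ.edgeElt τ e * A (Γ.t e) ^ q e * (Γ.edgeElt τ e)⁻¹ = A (Γ.o e) ^ p e := by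
    intro e
    have := Γ.edge_rel τ e (η e)
    rwa [hιo, hιt, map_zpow, map_zpow] at this
  have htree : ∀ e ∈ τ, A (Γ.t e) ^ q e = A (Γ.o e) ^ p e := by
    intro e he
    have := hrel e
    rwa [Γ.edgeElt_eq_one τ he, one_mul, inv_one, mul_one] at this
  have hgen : Subgroup.closure (Set.range A ∪ Set.range (Γ.edgeElt τ)) = ⊤ := by
    rw [eq_top_iff, ← PresentedGroup.closure_range_of, Subgroup.closure_le]
    have hAmem : ∀ v, A v ∈ Subgroup.closure (Set.range A ∪ Set.range (Γ.edgeElt τ)) :=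
      fun v => Subgroup.subset_closure (Or.inl ⟨v, rfl⟩)
    rintro _ ⟨⟨v, g⟩ | e, rfl⟩
    · have : PresentedGroup.of (rels := {r | Γ.Rel τ r}) (Sum.inl ⟨v, g⟩) =
          A v ^ (Multiplicative.toAdd (L v g)) := by
        change Γ.vertexHom τ v g = _
        conv_lhs => rw [hγ v g]
        rw [map_zpow]
      rw [this]
      exact zpow_mem (hAmem v) _
    · exact Subgroup.subset_closure (Or.inr ⟨e, rfl⟩)
  obtain ⟨v₀⟩ := hτ.2.2.connected.nonempty
  -- A tree edge identifies a nonzero power of one end generator with a nonzero power of the other;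
  -- this propagates along the maximal subtree.
  have hcomm : ∀ v, ∃ m n : ℤ, m ≠ 0 ∧ n ≠ 0 ∧ A v ^ m = A v₀ ^ n := by
    intro v
    obtain ⟨w⟩ := hτ.2.2.connected.preconnected v v₀
    induction w with
    | nil => exact ⟨1, 1, one_ne_zero, one_ne_zero, rfl⟩
    | @cons x y z hxy w ih =>
      obtain ⟨m, n, hm, hn, h⟩ := ih
      rw [SimpleGraph.fromEdgeSet_adj] at hxy
      obtain ⟨⟨e, he, hexy⟩, -⟩ := hxy
      simp only [Sym2.eq_iff] at hexy
      rcases hexy with ⟨rfl, rfl⟩ | ⟨rfl, rfl⟩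
      · refine ⟨p e * m, n * q e, mul_ne_zero (hp e) hm, mul_ne_zero hn (hq e), ?_⟩
        rw [zpow_mul, ← htree e he, zpow_mul, ← h, ← zpow_mul, ← zpow_mul, mul_comm]
      · refine ⟨q e * m, n * p e, mul_ne_zero (hq e) hm, mul_ne_zero hn (hp e), ?_⟩
        rw [zpow_mul, htree e he, zpow_mul, ← h, ← zpow_mul, ← zpow_mul, mul_comm]
  have hAll : powerCommensurator (A v₀) = ⊤ := by
    rw [eq_top_iff, ← hgen, Subgroup.closure_le]
    rintro _ (⟨v, rfl⟩ | ⟨e, rfl⟩)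
    · obtain ⟨m, n, hm, hn, h⟩ := hcomm v
      refine ⟨n, n, hn, hn, ?_⟩
      rw [← h]
      group
    · obtain ⟨m, n, hm, hn, h⟩ := hcomm (Γ.t e)
      obtain ⟨m', n', hm', hn', h'⟩ := hcomm (Γ.o e)
      -- The exponents make A(v₀)^(n q m') equal to A(t e)^(q m m'), which the edge element
      -- conjugates to A(o e)^(p m m') = A(v₀)^(n' p m).
      refine ⟨n * (q e * m'), n' * (p e * m), mul_ne_zero hn (mul_ne_zero (hq e) hm'),
        mul_ne_zero hn' (mul_ne_zero (hp e) hm), ?_⟩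
      rw [zpow_mul, ← h, zpow_mul _ n', ← h', ← zpow_mul, ← zpow_mul,
        show m * (q e * m') = q e * (m * m') by ring,
        show m' * (p e * m) = p e * (m * m') by ring, zpow_mul, zpow_mul _ (p e), ← conj_zpow, hrel]
  -- the affine action on `ℚ`
  have hord : ∀ n : ℤ, n ≠ 0 → A v₀ ^ n ≠ 1 := by
    have hpq : ∀ e, (p e : ℚ) ≠ 0 := fun e => Int.cast_ne_zero.2 (hp e)
    have hqq : ∀ e, (q e : ℚ) ≠ 0 := fun e => Int.cast_ne_zero.2 (hq e)
    -- The generator at `v` is to act as translation by `r v`, and the edge `e` as multiplication by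
    -- `c e`. The edge relation requires c(e) r(t e) q(e) = r(o e) p(e), and the tree relation
    -- requires c(e) = 1; the potential for the labels p/q makes both hold. Then `A v₀ ^ n`
    -- translates by n r(v₀), which is nonzero for n ≠ 0.
    obtain ⟨r, hr⟩ := hτ.exists_potential
      (fun e => Units.mk0 (p e : ℚ) (hpq e) / Units.mk0 (q e : ℚ) (hqq e))
    let c : Γ.E → ℚˣ := fun e => r (Γ.o e) * (Units.mk0 (p e : ℚ) (hpq e)) *
      (r (Γ.t e) * (Units.mk0 (q e : ℚ) (hqq e)))⁻¹
    have hc : ∀ e, (c e : ℚ) * (r (Γ.t e) * q e) = r (Γ.o e) * p e := by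
      intro e
      have h1 : c e * (r (Γ.t e) * (Units.mk0 (q e : ℚ) (hqq e))) =
          r (Γ.o e) * (Units.mk0 (p e : ℚ) (hpq e)) := by
        simp only [c, inv_mul_cancel_right]
      simpa using congrArg Units.val h1
    have hc1 : ∀ e ∈ τ, c e = 1 := by
      intro e he
      simp only [c, hr e he]
      rw [mul_assoc (r (Γ.o e)) (_ / _), div_mul_cancel, mul_inv_cancel]
    let f : (Σ v, Γ.Gv v) ⊕ Γ.E → Equiv.Perm ℚ := Sum.elim
      (fun x => Equiv.addRight ((r x.1 : ℚ) * (Multiplicative.toAdd (L x.1 x.2) : ℤ)))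
      (fun e => MulAction.toPerm (c e))
    have hf : ∀ x ∈ {x | Γ.Rel τ x}, FreeGroup.lift f x = 1 := by
      rintro _ (⟨v, g, h⟩ | ⟨e, h⟩ | ⟨e, he⟩)
      · simp only [GraphOfGroups.vgen, map_mul, map_inv, FreeGroup.lift_apply_of, f, Sum.elim_inl,
          mul_inv_eq_one, addRight_mul_addRight, toAdd_mul, Int.cast_add, mul_add]
      · have ho : Multiplicative.toAdd (L (Γ.o e) (Γ.ιo e h)) =
            p e * Multiplicative.toAdd (Le e h) := by
          conv_lhs => rw [hη e h, map_zpow, map_zpow, toAdd_zpow, smul_eq_mul, mul_comm]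
        have ht : Multiplicative.toAdd (L (Γ.t e) (Γ.ιt e h)) =
            q e * Multiplicative.toAdd (Le e h) := by
          conv_lhs => rw [hη e h, map_zpow, map_zpow, toAdd_zpow, smul_eq_mul, mul_comm]
        simp only [GraphOfGroups.vgen, GraphOfGroups.egen, map_mul, map_inv,
          FreeGroup.lift_apply_of, f, Sum.elim_inl, Sum.elim_inr, mul_inv_eq_one]
        rw [mul_inv_eq_iff_eq_mul, ho, ht]
        apply Equiv.ext
        intro x
        simp only [Equiv.Perm.mul_apply, Equiv.coe_addRight, MulAction.toPerm_apply, Units.smul_def,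
          smul_eq_mul, mul_add, Int.cast_mul]
        rw [← mul_assoc (r (Γ.o e) : ℚ), ← hc e]
        ring
      · simp only [GraphOfGroups.egen, FreeGroup.lift_apply_of, f, Sum.elim_inr, hc1 e he]
        exact Equiv.ext fun x => one_smul ℚˣ x
    let F : Γ.FundamentalGroup τ →* Equiv.Perm ℚ := PresentedGroup.toGroup hf
    intro n hn h
    have h1 : F (A v₀ ^ n) = 1 := by rw [h, map_one]
    have h2 : A v₀ ^ n = PresentedGroup.of (Sum.inl ⟨v₀, γ v₀ ^ n⟩) := by
      change _ = Γ.vertexHom τ v₀ (γ v₀ ^ n)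
      rw [map_zpow]
    rw [h2] at h1
    have h3 := congrArg (fun e : Equiv.Perm ℚ => e 0) h1
    simp only [F, PresentedGroup.toGroup.of, f, Sum.elim_inl, Equiv.coe_addRight, map_zpow, γ,
      MulEquiv.apply_symm_apply, Equiv.Perm.one_apply, zero_add, toAdd_zpow, toAdd_ofAdd,
      smul_eq_mul, mul_one] at h3
    exact mul_ne_zero (r v₀).ne_zero (Int.cast_ne_zero.2 hn) h3
  refine ⟨?_, φ.symm (A v₀), ?_, ?_⟩
  · have : Group.FG (Γ.FundamentalGroup τ) :=
      Group.fg_iff.2 ⟨_, hgen, (Set.finite_range _).union (Set.finite_range _)⟩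
    exact Group.fg_of_surjective (f := φ.symm.toMonoidHom) φ.symm.surjective
  · intro n hn h
    rw [← map_zpow, map_eq_one_iff _ φ.symm.injective] at h
    exact hord n hn h
  · rw [eq_top_iff]
    intro g _
    have : φ g ∈ powerCommensurator (A v₀) := hAll ▸ Subgroup.mem_top _
    obtain ⟨m, n, hm, hn, h⟩ := this
    refine ⟨m, n, hm, hn, ?_⟩
    rw [← map_zpow φ.symm (A v₀) m, ← map_zpow φ.symm (A v₀) n, ← h, map_mul, map_mul, map_inv, MulEquiv.symm_apply_apply]

end

/-! ### Common elliptic subgroups, and finiteness of the quotient graph -/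

noncomputable section

theorem Group.FG.to_countable {G : Type*} [Group G] (hG : Group.FG G) : Countable G := by
  obtain ⟨S, hS, φ, hφ⟩ :=
    Monoid.fg_iff_exists_freeMonoid_hom_surjective.1 (Group.fg_iff_monoid_fg.1 hG)
  have := hS.countable.to_subtype
  have : Countable (FreeMonoid S) := inferInstanceAs (Countable (List S))
  exact hφ.countable

namespace GTree

variable {G : Type u} [Group G]

theorem zpow_smul_eq_of_smul_eq {X : Type*} [MulAction G X] {g : G} {x : X} (h : g • x = x)
    (n : ℤ) : g ^ n • x = x :=
  MulAction.mem_stabilizer_iff.1 (zpow_mem (MulAction.mem_stabilizer_iff.2 h) n)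

/-- Fixed point sets are convex. -/
theorem smul_eq_of_closer (T : GTree.{u, v} G) {g : G} {x y w : T.V} (hx : g • x = x)
    (hy : g • y = y) (hw : T.graph.Adj x w) (hd : T.graph.dist w y + 1 = T.graph.dist x y) :
    g • w = w := by
  refine T.isTree.eq_of_adj_closer (v := x) (w := y) ?_ hw ?_ (by omega)
  · have := T.adj_smul g _ _ hw
    rwa [hx] at this
  · have := T.dist_smul g w y
    rw [hy] at this
    omega

theorem dist_zpow_natAbs (T : GTree.{u, v} G) (a : G) (x : T.V) (n : ℤ) :
    T.graph.dist x (a ^ n • x) = T.graph.dist x (a ^ n.natAbs • x) := by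
  rcases Int.natAbs_eq n with h | h
  · conv_lhs => rw [h, zpow_natCast]
  · conv_lhs => rw [h, zpow_neg, zpow_natCast, SimpleGraph.dist_comm, T.dist_smul_left, inv_inv]

/-- A commensurated element of a non-solvable group is elliptic in every minimal tree with cyclic
stabilizers. -/
theorem exists_fixed_of_commensurated (T : GTree.{u, v} G) (hT : T.IsCyclicMinimal)
    (hFG : Group.FG G) (hns : ¬ Group.IsSolvable G) (a : G) (ha : powerCommensurator a = ⊤) :
    ∃ x : T.V, a • x = x := by
  by_contra! hfix
  obtain ⟨ℓ, hℓ, ⟨x₀, hx₀⟩, hle⟩ := T.exists_translation a hfix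
  have hx₀' : ∀ n : ℤ, T.graph.dist x₀ (a ^ n • x₀) = n.natAbs * ℓ := fun n => by
    rw [T.dist_zpow_natAbs, hx₀]
  have hle' : ∀ x (n : ℤ), n.natAbs * ℓ ≤ T.graph.dist x (a ^ n • x) := fun x n => by
    rw [T.dist_zpow_natAbs]; exact hle _ _
  -- Conjugate elements have the same minimal displacement, so if `g` conjugates `a ^ p` to `a ^ q`
  -- then |p| ℓ = |q| ℓ.
  have habs : ∀ g : G, ∃ p : ℤ, p ≠ 0 ∧ (g * a ^ p * g⁻¹ = a ^ p ∨ g * a ^ p * g⁻¹ = a ^ (-p)) := by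
    intro g
    have hg : g ∈ powerCommensurator a := ha ▸ Subgroup.mem_top g
    obtain ⟨p, q, hp, hq, h⟩ := hg
    have hd : ∀ x, T.graph.dist x (a ^ p • x) = T.graph.dist (g • x) (a ^ q • g • x) := by
      intro x
      rw [← h, ← mul_smul, inv_mul_cancel_right, mul_smul, T.dist_smul]
    have h1 := hd x₀
    have h2 := hd (g⁻¹ • x₀)
    rw [smul_inv_smul] at h2
    rw [hx₀'] at h1 h2
    have h3 := hle' (g • x₀) q
    have h4 := hle' (g⁻¹ • x₀) p
    rw [← h1] at h3
    rw [h2] at h4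
    have h5 : p.natAbs = q.natAbs := le_antisymm (Nat.le_of_mul_le_mul_right h4 hℓ)
      (Nat.le_of_mul_le_mul_right h3 hℓ)
    refine ⟨p, hp, ?_⟩
    rcases Int.natAbs_eq_natAbs_iff.1 h5 with h6 | h6
    · left; rw [h, h6]
    · right; rw [h, h6, neg_neg]
  choose p hp hpa using habs
  obtain ⟨S, hS, hSfin⟩ := Group.fg_iff.1 hFG
  -- A common multiple of the exponents of the generators: each generator sends `a ^ N` to itself or
  -- its inverse, and this property is closed under products and inverses.
  let N : ℤ := ∏ g ∈ hSfin.toFinset, p g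
  have hN : N ≠ 0 := Finset.prod_ne_zero_iff.2 fun g _ => hp g
  have hz : ∀ x : T.V, a ^ N • x ≠ x := by
    intro x h
    have := hle' x N
    rw [h, SimpleGraph.dist_self] at this
    have : 0 < N.natAbs * ℓ := Nat.mul_pos (Int.natAbs_pos.2 hN) hℓ
    omega
  have hnorm : ∀ g : G, g * a ^ N * g⁻¹ = a ^ N ∨ g * a ^ N * g⁻¹ = (a ^ N)⁻¹ := by
    intro g
    have hg : g ∈ Subgroup.closure S := hS ▸ Subgroup.mem_top g
    induction hg using Subgroup.closure_induction with
    | mem g hg =>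
      obtain ⟨k, hk⟩ : p g ∣ N := Finset.dvd_prod_of_mem p (hSfin.mem_toFinset.2 hg)
      rcases hpa g with h | h
      · left
        rw [hk, zpow_mul, ← conj_zpow, h]
      · right
        rw [hk, zpow_mul, ← conj_zpow, h, ← zpow_mul, ← zpow_mul, ← zpow_neg, neg_mul]
    | one => left; simp
    | mul g h _ _ hg hh =>
      have e : g * h * a ^ N * (g * h)⁻¹ = g * (h * a ^ N * h⁻¹) * g⁻¹ := by group
      rw [e]
      rcases hh with hh | hh
      · rw [hh]; exact hg
      · rw [hh, ← conj_inv]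
        rcases hg with hg | hg
        · right; rw [hg]
        · left; rw [hg, inv_inv]
    | inv g _ hg =>
      rcases hg with hg | hg
      · left
        conv_lhs => rw [← hg]
        group
      · right
        have : a ^ N = g * (a ^ N)⁻¹ * g⁻¹ := by rw [← conj_inv, hg, inv_inv]
        conv_lhs => rw [this]
        group
  exact hns (T.isSolvable_of_normal_translation hT.1 hT.2.1 _ hz hnorm)

/-- Every vertex stabilizer of a minimal tree contains a power of a commensurated elliptic
element. -/
theorem exists_zpow_smul_eq (T : GTree.{u, v} G) (hT : T.IsMinimal) (a : G)
    (ha : powerCommensurator a = ⊤) (hfix : ∃ x : T.V, a • x = x) (x : T.V) :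
    ∃ n : ℤ, n ≠ 0 ∧ a ^ n • x = x := by
  -- The set is invariant because every `g` commensurates `a`, and convex because a common power
  -- fixes both of two given points, hence the geodesic between them.
  have hS := hT {x | ∃ n : ℤ, n ≠ 0 ∧ a ^ n • x = x} ?_ ?_
  · have : x ∈ {x : T.V | ∃ n : ℤ, n ≠ 0 ∧ a ^ n • x = x} := hS ▸ Set.mem_univ x
    exact this
  · rintro g x ⟨n, hn, hx⟩
    have hg : g ∈ powerCommensurator a := ha ▸ Subgroup.mem_top g
    obtain ⟨p, q, hp, hq, h⟩ := hg
    refine ⟨q * n, mul_ne_zero hq hn, ?_⟩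
    rw [zpow_mul, ← h, conj_zpow, ← mul_smul, inv_mul_cancel_right, mul_smul, ← zpow_mul,
      mul_comm, zpow_mul, zpow_smul_eq_of_smul_eq hx]
  · obtain ⟨w, hw⟩ := hfix
    refine T.isTree.connected_induce _ ⟨w, 1, one_ne_zero, by simpa using hw⟩ ?_
    rintro x ⟨n, hn, hx⟩ y ⟨m, hm, hy⟩ z hz hd
    refine ⟨n * m, mul_ne_zero hn hm, ?_⟩
    refine T.smul_eq_of_closer (x := x) (y := y) ?_ ?_ hz hd
    · rw [zpow_mul, zpow_smul_eq_of_smul_eq hx]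
    · rw [mul_comm, zpow_mul, zpow_smul_eq_of_smul_eq hy]

/-- In a non-solvable generalized Baumslag-Solitar group, vertex stabilizers of one tree fix
vertices of any other. -/
theorem exists_stabilizer_le (hG : IsGBS G) (hns : ¬ Group.IsSolvable G) (T T' : GTree.{u, v} G)
    (hT : T.IsCyclicMinimal) (hT' : T'.IsCyclicMinimal) (x : T.V) :
    ∃ y : T'.V, MulAction.stabilizer G x ≤ MulAction.stabilizer G y := by
  obtain ⟨hFG, a, ha, hcomm⟩ := hG.fg_and_exists_commensurated
  obtain ⟨n, hn, hx⟩ := T.exists_zpow_smul_eq hT.1 a hcomm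
    (T.exists_fixed_of_commensurated hT hFG hns a hcomm) x
  obtain ⟨y', hy'⟩ := T'.exists_fixed_of_commensurated hT' hFG hns a hcomm
  -- Since `a` has infinite order, the power of `b` that equals `a ^ n` has nonzero exponent `m`. So
  -- `b` is a root of an element elliptic in `T'`, and a fixed vertex of `b` is fixed by the whole
  -- stabilizer.
  obtain ⟨b, hb⟩ := (hT.2.1 x).exists_generator
  obtain ⟨m, hm⟩ := Subgroup.mem_zpowers_iff.1 (hb ⟨a ^ n, hx⟩)
  have hm' : (b : G) ^ m = a ^ n := by simpa using congrArg Subtype.val hm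
  have hm0 : m ≠ 0 := by
    rintro rfl
    exact ha n hn (by rw [← hm', zpow_zero])
  have hbm : (b : G) ^ m • y' = y' := by rw [hm', zpow_smul_eq_of_smul_eq hy']
  obtain ⟨y, hy⟩ := T'.exists_fixed_of_pow (b : G) m.natAbs (Int.natAbs_pos.2 hm0) y' (by
    have h := T'.dist_zpow_natAbs b y' m
    rw [hbm, SimpleGraph.dist_self] at h
    exact (T'.isTree.connected.dist_eq_zero_iff.1 h.symm).symm)
  refine ⟨y, fun g hg => ?_⟩
  obtain ⟨k, hk⟩ := Subgroup.mem_zpowers_iff.1 (hb ⟨g, hg⟩)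
  have hk' : (b : G) ^ k = g := by simpa using congrArg Subtype.val hk
  rw [MulAction.mem_stabilizer_iff, ← hk', zpow_smul_eq_of_smul_eq hy]

/-- The quotient of a minimal tree by a finitely generated group is finite. -/
theorem finite_quotientEdge (T : GTree.{u, v} G) (hT : T.IsMinimal) (hFG : Group.FG G) :
    Finite T.QuotientEdge := by
  have hc := T.isTree.connected
  obtain ⟨S, hS, hSfin⟩ := Group.fg_iff.1 hFG
  obtain ⟨w⟩ := hc.nonempty
  have P : ∀ g : G, T.graph.Walk w (g • w) := fun g => (hc.preconnected w (g • w)).some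
  -- The finitely many edges on the paths from `w` to its translates by generators. Their translates
  -- form `H`, which joins `w` to its whole orbit; the component of `w` in `H` is therefore an
  -- invariant subtree, hence everything.
  let E₀ : Set (Sym2 T.V) := ⋃ g ∈ S, {e | e ∈ (P g).edges}
  have hE₀ : E₀.Finite := hSfin.biUnion fun g _ => List.finite_toSet _
  let H : SimpleGraph T.V :=
    { Adj := fun x y => T.graph.Adj x y ∧ ∃ g : G, s(g • x, g • y) ∈ E₀
      symm := ⟨fun x y h => ⟨h.1.symm, h.2.imp fun g hg => by rwa [Sym2.eq_swap]⟩⟩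
      loopless := ⟨fun x h => h.1.ne rfl⟩ }
  have hHle : H ≤ T.graph := fun x y h => h.1
  have hHsmul : ∀ (g : G) x y, H.Adj x y → H.Adj (g • x) (g • y) := by
    rintro g x y ⟨h, k, hk⟩
    refine ⟨T.adj_smul g x y h, k * g⁻¹, ?_⟩
    rwa [← mul_smul, ← mul_smul, inv_mul_cancel_right]
  have hreach : ∀ (g : G) x y, H.Reachable x y → H.Reachable (g • x) (g • y) := by
    rintro g x y ⟨p⟩
    let φ : H →g H := ⟨fun x => g • x, fun {x y} h => hHsmul g x y h⟩
    exact ⟨p.map φ⟩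
  have hwalk : ∀ x y (p : T.graph.Walk x y), (∀ e ∈ p.edges, e ∈ E₀) → H.Reachable x y := by
    intro x y p
    induction p with
    | nil => exact fun _ => SimpleGraph.Reachable.refl _
    | @cons x y z h p ih =>
      intro he
      rw [SimpleGraph.Walk.edges_cons] at he
      have hadj : H.Adj x y := ⟨h, 1, by simpa using he _ List.mem_cons_self⟩
      exact hadj.reachable.trans (ih fun e h' => he e (List.mem_cons_of_mem _ h'))
  have horb : ∀ g : G, H.Reachable w (g • w) := by
    intro g
    have hg : g ∈ Subgroup.closure S := hS ▸ Subgroup.mem_top g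
    induction hg using Subgroup.closure_induction with
    | mem g hg => exact hwalk _ _ (P g) fun e he => Set.mem_biUnion hg he
    | one => rw [one_smul]
    | mul g h _ _ hg hh =>
      rw [mul_smul]
      exact hg.trans (hreach g _ _ hh)
    | inv g _ hg =>
      have := hreach g⁻¹ _ _ hg
      rw [inv_smul_smul] at this
      exact this.symm
  have hC : {x | H.Reachable w x} = Set.univ := by
    refine hT _ (fun g x hx => (horb g).trans (hreach g _ _ hx)) ?_
    have key : ∀ x y (p : H.Walk x y) (hx : H.Reachable w x), ∃ hy : H.Reachable w y,
        (T.graph.induce {x | H.Reachable w x}).Reachable ⟨x, hx⟩ ⟨y, hy⟩ := by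
      intro x y p
      induction p with
      | nil => exact fun hx => ⟨hx, SimpleGraph.Reachable.refl _⟩
      | @cons x y z h p ih =>
        intro hx
        have hy : H.Reachable w y := hx.trans h.reachable
        obtain ⟨hz, h'⟩ := ih hy
        refine ⟨hz, SimpleGraph.Reachable.trans (SimpleGraph.Adj.reachable ?_) h'⟩
        exact h.1
    have key' : ∀ x (hx : H.Reachable w x),
        (T.graph.induce {x | H.Reachable w x}).Reachable ⟨w, SimpleGraph.Reachable.refl _⟩
          ⟨x, hx⟩ := by
      rintro x ⟨p⟩
      exact (key w x p (SimpleGraph.Reachable.refl _)).2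
    rw [SimpleGraph.connected_iff]
    exact ⟨fun x y => (key' x.1 x.2).symm.trans (key' y.1 y.2),
      ⟨⟨w, SimpleGraph.Reachable.refl _⟩⟩⟩
  have hH : H.Connected := by
    rw [SimpleGraph.connected_iff]
    have hr : ∀ x, H.Reachable w x := fun x => by
      have : x ∈ {x | H.Reachable w x} := hC ▸ Set.mem_univ x
      exact this
    exact ⟨fun x y => (hr x).symm.trans (hr y), ⟨w⟩⟩
  -- A tree has no proper connected spanning subgraph, so every edge is a translate of one in `E₀`.
  have hHT : T.graph ≤ H := (SimpleGraph.isTree_iff_minimal_connected.1 T.isTree).2 hH hHle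
  have hfin : Finite {e : T.graph.edgeSet // e.1 ∈ E₀} := by
    have := hE₀.to_subtype
    exact Finite.of_injective (fun e => (⟨e.1.1, e.2⟩ : E₀)) fun e f h =>
      Subtype.ext (Subtype.ext (Subtype.mk.inj h))
  refine Finite.of_surjective
    (fun e : {e : T.graph.edgeSet // e.1 ∈ E₀} => (Quotient.mk'' e.1 : T.QuotientEdge)) ?_
  intro q
  induction q using Quotient.inductionOn' with
  | h e =>
    obtain ⟨e, he⟩ := e
    induction e using Sym2.ind with
    | _ x y =>
      obtain ⟨-, g, hg⟩ := hHT he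
      exact ⟨⟨⟨s(g • x, g • y), T.adj_smul g x y he⟩, hg⟩, Quotient.sound' ⟨g, rfl⟩⟩

theorem quotientLen_pos (T : GTree.{u, v} G) (q : T.QuotientEdge) : 0 < T.quotientLen q := by
  induction q using Quotient.inductionOn' with
  | h e =>
    obtain ⟨e, he⟩ := e
    induction e using Sym2.ind with
    | _ x y => exact T.len_pos x y he

/-- A non-solvable group does not have a tree with one vertex in its cyclic deformation space. -/
theorem nontrivial_of_not_isSolvable (T : GTree.{u, v} G) (hT : T.IsCyclicMinimal)
    (hns : ¬ Group.IsSolvable G) : Nontrivial T.V := by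
  by_contra hsub
  rw [not_nontrivial_iff_subsingleton] at hsub
  apply hns
  obtain ⟨w⟩ := T.isTree.connected.nonempty
  have hcyc := hT.2.1 w
  have htop : MulAction.stabilizer G w = ⊤ := by
    rw [eq_top_iff]
    exact fun g _ => Subsingleton.elim (g • w) w
  rw [htop] at hcyc
  have hG : IsCyclic G := (Subgroup.topEquiv (G := G)).isCyclic.1 hcyc
  let _ := IsCyclic.commGroup (α := G)
  exact Group.isSolvable_of_comm (G := G) mul_comm

theorem exists_adj (T : GTree.{u, v} G) [Nontrivial T.V] (x : T.V) : ∃ y, T.graph.Adj x y := by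
  obtain ⟨z, hz⟩ := exists_ne x
  obtain ⟨y, hy, -⟩ := T.isTree.exists_adj_closer hz.symm
  exact ⟨y, hy⟩

theorem vol_pos (T : GTree.{u, v} G) [Nontrivial T.V] [Finite T.QuotientEdge] : 0 < T.vol := by
  have := Fintype.ofFinite T.QuotientEdge
  rw [vol, finsum_eq_sum_of_fintype]
  refine Finset.sum_pos (fun q _ => T.quotientLen_pos q) ?_
  rw [Finset.univ_nonempty_iff]
  obtain ⟨w⟩ := T.isTree.connected.nonempty
  obtain ⟨y, hy⟩ := T.exists_adj w
  exact ⟨Quotient.mk'' ⟨s(w, y), hy⟩⟩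

end GTree

end

/-! ### The geometric realization and its path metric -/

noncomputable section

open scoped NNReal ENNReal

namespace GTree

variable {G : Type u} [Group G] {T T' : GTree.{u, v} G}

theorem bary_zero {V : Type v} (a b : V) : bary a b 0 = Finsupp.single a 1 := by
  simp [bary]

theorem bary_one {V : Type v} (a b : V) : bary a b 1 = Finsupp.single b 1 := by
  simp [bary]

theorem bary_self {V : Type v} (a : V) (s : ℝ) : bary a a s = Finsupp.single a 1 := by
  rw [bary, ← Finsupp.single_add, sub_add_cancel]

theorem bary_swap {V : Type v} (a b : V) (s : ℝ) : bary b a (1 - s) = bary a b s := by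
  rw [bary, bary, sub_sub_cancel, add_comm]

theorem bary_apply_right {V : Type v} {a b : V} (h : a ≠ b) (s : ℝ) : bary a b s b = s := by
  simp [bary, h]

theorem bary_apply_left {V : Type v} {a b : V} (h : a ≠ b) (s : ℝ) : bary a b s a = 1 - s := by
  simp [bary, h.symm]

theorem bary_apply_of_ne {V : Type v} {a b c : V} (ha : a ≠ c) (hb : b ≠ c) (s : ℝ) :
    bary a b s c = 0 := by
  simp [bary, ha, hb]

theorem smul_val (g : G) (x : T.Realization) :
    (g • x).1 = Finsupp.mapDomain (fun a => g • a) x.1 := rfl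

/-- A vertex, as a point of the realization. -/
def vertexPt (T : GTree.{u, v} G) (a : T.V) : T.Realization :=
  ⟨Finsupp.single a 1, a, a, Or.inl rfl, 0, ⟨le_rfl, zero_le_one⟩, (bary_zero a a).symm⟩

/-- The parametrization of an edge by `[0, 1]`, extended to the real line by constants. -/
def edgePt {a b : T.V} (h : T.graph.Adj a b) (s : ℝ) : T.Realization :=
  ⟨bary a b (Set.projIcc (0 : ℝ) 1 zero_le_one s), a, b, Or.inr h, _, Subtype.coe_prop _, rfl⟩

theorem edgePt_val {a b : T.V} (h : T.graph.Adj a b) {s : ℝ} (hs : s ∈ Set.Icc (0 : ℝ) 1) :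
    (edgePt h s).1 = bary a b s := by
  simp only [edgePt, Set.projIcc_of_mem _ hs]

theorem OnEdge.eq_edgePt {a b : T.V} {x : T.Realization} (hx : T.OnEdge a b x)
    (h : T.graph.Adj a b) : ∃ s ∈ Set.Icc (0 : ℝ) 1, x = edgePt h s := by
  obtain ⟨s, hs, hx⟩ := hx
  exact ⟨s, hs, Subtype.ext (by rw [hx, edgePt_val h hs])⟩

theorem onEdge_edgePt {a b : T.V} (h : T.graph.Adj a b) (s : ℝ) : T.OnEdge a b (edgePt h s) :=
  ⟨_, Subtype.coe_prop _, rfl⟩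

theorem smul_edgePt {a b : T.V} (h : T.graph.Adj a b) (g : G) (s : ℝ) :
    g • edgePt h s = edgePt (T.adj_smul g a b h) s :=
  Subtype.ext (mapDomain_bary _ a b _)

theorem smul_vertexPt (g : G) (a : T.V) : g • T.vertexPt a = T.vertexPt (g • a) :=
  Subtype.ext Finsupp.mapDomain_single

/-- Every point is a vertex or lies on an edge. -/
theorem Realization.cases_on_edge (x : T.Realization) :
    (∃ a, x = T.vertexPt a) ∨ ∃ (a b : T.V) (h : T.graph.Adj a b),
      ∃ s ∈ Set.Icc (0 : ℝ) 1, x = edgePt h s := by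
  obtain ⟨x, a, b, h | h, s, hs, hx⟩ := x
  · subst h
    exact Or.inl ⟨a, Subtype.ext (by simp only [hx, bary_self, vertexPt])⟩
  · exact Or.inr ⟨a, b, h, s, hs, Subtype.ext (by rw [edgePt_val h hs]; exact hx)⟩

theorem edgePt_zero {a b : T.V} (h : T.graph.Adj a b) : edgePt h 0 = T.vertexPt a :=
  Subtype.ext (by rw [edgePt_val h ⟨le_rfl, zero_le_one⟩, bary_zero, vertexPt])

theorem edgePt_one {a b : T.V} (h : T.graph.Adj a b) : edgePt h 1 = T.vertexPt b :=
  Subtype.ext (by rw [edgePt_val h ⟨zero_le_one, le_rfl⟩, bary_one, vertexPt])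

theorem exists_pathLen_vertexPt (a b : T.V) : ∃ r, T.PathLen (T.vertexPt a) (T.vertexPt b) r := by
  obtain ⟨p⟩ := T.isTree.connected.preconnected a b
  induction p with
  | nil => exact ⟨0, PathLen.nil _⟩
  | @cons a b c h p ih =>
    obtain ⟨r, hr⟩ := ih
    refine ⟨_, PathLen.cons a b h ?_ ?_ hr⟩
    · rw [← edgePt_zero h]; exact onEdge_edgePt h 0
    · rw [← edgePt_one h]; exact onEdge_edgePt h 1

/-- Any two points are joined by a path. -/
theorem exists_pathLen (x y : T.Realization) : ∃ r, T.PathLen x y r := by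
  have key : ∀ x : T.Realization, ∃ a r, T.PathLen x (T.vertexPt a) r := by
    intro x
    rcases x.cases_on_edge with ⟨a, rfl⟩ | ⟨a, b, h, s, hs, rfl⟩
    · exact ⟨a, 0, PathLen.nil _⟩
    · refine ⟨a, _, PathLen.cons a b h (onEdge_edgePt h s) ?_ (PathLen.nil _)⟩
      rw [← edgePt_zero h]; exact onEdge_edgePt h 0
  obtain ⟨a, r, h⟩ := key x
  obtain ⟨b, s, h'⟩ := key y
  obtain ⟨t, h''⟩ := exists_pathLen_vertexPt a b
  exact ⟨_, (h.trans h'').trans h'.symm⟩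

theorem edist_le_of_pathLen {x y : T.Realization} {r : ℝ} (h : T.PathLen x y r) :
    edist x y ≤ ENNReal.ofReal r :=
  iInf₂_le r h

theorem edist_ne_top (x y : T.Realization) : edist x y ≠ ⊤ := by
  obtain ⟨r, hr⟩ := exists_pathLen x y
  exact ne_top_of_le_ne_top ENNReal.ofReal_ne_top (edist_le_of_pathLen hr)

/-- A map is Lipschitz as soon as it is so on every edge. -/
theorem lipschitzWith_of_edges {Y : Type*} [PseudoEMetricSpace Y] {f : T.Realization → Y} (C : ℝ≥0)
    (h : ∀ (a b : T.V), T.graph.Adj a b → ∀ x y : T.Realization, T.OnEdge a b x → T.OnEdge a b y →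
      edist (f x) (f y) ≤ C * ENNReal.ofReal (T.len s(a, b) * |x.1 b - y.1 b|)) :
    LipschitzWith C f := by
  have key : ∀ {x y : T.Realization} {r : ℝ}, T.PathLen x y r →
      edist (f x) (f y) ≤ C * ENNReal.ofReal r := by
    intro x y r hr
    induction hr with
    | nil x => simp
    | @cons x y z r a b hab hx hy hr ih =>
      rw [ENNReal.ofReal_add (mul_nonneg (T.len_pos a b hab).le (abs_nonneg _)) hr.nonneg, mul_add]
      exact (edist_triangle _ (f y) _).trans (add_le_add (h a b hab x y hx hy) ih)
  intro x y
  -- Multiplication by a nonzero finite constant commutes with the infimum over paths. For C = 0 a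
  -- single path already gives the bound.
  rcases eq_or_ne C 0 with rfl | hC
  · obtain ⟨r, hr⟩ := exists_pathLen x y
    refine (key hr).trans ?_
    simp
  · have e : edist x y = ⨅ (r : ℝ) (_ : T.PathLen x y r), ENNReal.ofReal r := rfl
    rw [e, ENNReal.mul_iInf_of_ne (by simpa using hC) ENNReal.coe_ne_top]
    refine le_iInf fun r => ?_
    rw [ENNReal.mul_iInf_of_ne (by simpa using hC) ENNReal.coe_ne_top]
    exact le_iInf fun hr => key hr

theorem abs_projIcc_sub_le (s t : ℝ) :
    |(Set.projIcc (0 : ℝ) 1 zero_le_one s : ℝ) - Set.projIcc (0 : ℝ) 1 zero_le_one t| ≤ |s - t| := by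
  have := (LipschitzWith.projIcc (zero_le_one (α := ℝ))).dist_le_mul s t
  rwa [NNReal.coe_one, one_mul, Subtype.dist_eq, Real.dist_eq, Real.dist_eq] at this

theorem lipschitzWith_edgePt {a b : T.V} (h : T.graph.Adj a b) :
    LipschitzWith (T.len s(a, b)).toNNReal (edgePt h) := by
  intro s t
  have hl := (T.len_pos a b h).le
  have := edist_le_of_pathLen
    (PathLen.cons a b h (onEdge_edgePt h s) (onEdge_edgePt h t) (PathLen.nil _))
  refine this.trans ?_
  rw [add_zero, edist_dist, Real.dist_eq, ← ENNReal.ofReal_coe_nnreal, Real.coe_toNNReal _ hl,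
    ← ENNReal.ofReal_mul hl]
  refine ENNReal.ofReal_le_ofReal (mul_le_mul_of_nonneg_left ?_ hl)
  simp only [edgePt, bary_apply_right h.ne]
  exact abs_projIcc_sub_le s t

/-- Each piece of a broken path lies in the continuous image of a line. Connectedness is what allows
the intermediate value theorem in `exists_side_eq`. -/
instance : PreconnectedSpace T.Realization := by
  have key : ∀ {x y : T.Realization} {r : ℝ}, T.PathLen x y r →
      connectedComponent x = connectedComponent y := by
    intro x y r hr
    induction hr with
    | nil x => rfl
    | @cons x y z r a b hab hx hy hr ih =>
      rw [← ih]
      apply connectedComponent_eq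
      obtain ⟨s, -, rfl⟩ := hx.eq_edgePt hab
      obtain ⟨t, -, rfl⟩ := hy.eq_edgePt hab
      exact (isPreconnected_range (lipschitzWith_edgePt hab).continuous).subset_connectedComponent
        ⟨s, rfl⟩ ⟨t, rfl⟩
  refine ⟨isPreconnected_of_forall_pair fun x _ y _ => ?_⟩
  obtain ⟨r, hr⟩ := exists_pathLen x y
  refine ⟨connectedComponent x, Set.subset_univ _, mem_connectedComponent, ?_,
    isPreconnected_connectedComponent⟩
  rw [key hr]
  exact mem_connectedComponent

/-! ### Projection of a tree to one of its edges -/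

/-- The extension of a function on the vertices which is affine on the edges. -/
def affineExt (φ : T.V → ℝ) (x : T.Realization) : ℝ := Finsupp.linearCombination ℝ φ x.1

theorem affineExt_of_val (φ : T.V → ℝ) {x : T.Realization} {a b : T.V} {s : ℝ}
    (h : x.1 = bary a b s) : affineExt φ x = (1 - s) * φ a + s * φ b := by
  rw [affineExt, h, bary, map_add, Finsupp.linearCombination_single,
    Finsupp.linearCombination_single, smul_eq_mul, smul_eq_mul]

theorem affineExt_smul (φ : T.V → ℝ) (g : G) (x : T.Realization) :
    affineExt φ (g • x) = affineExt (fun a => φ (g • a)) x := by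
  rw [affineExt, smul_val, Finsupp.linearCombination_mapDomain]
  rfl

theorem lipschitzWith_affineExt (φ : T.V → ℝ) (C : ℝ≥0)
    (h : ∀ a b, T.graph.Adj a b → |φ a - φ b| ≤ C * T.len s(a, b)) :
    LipschitzWith C (affineExt φ : T.Realization → ℝ) := by
  apply lipschitzWith_of_edges
  rintro a b hab x y ⟨s, hs, hx⟩ ⟨t, ht, hy⟩
  rw [affineExt_of_val φ hx, affineExt_of_val φ hy, hx, hy, bary_apply_right hab.ne,
    bary_apply_right hab.ne, edist_dist, Real.dist_eq, ← ENNReal.ofReal_coe_nnreal,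
    ← ENNReal.ofReal_mul C.coe_nonneg]
  apply ENNReal.ofReal_le_ofReal
  have e : (1 - s) * φ a + s * φ b - ((1 - t) * φ a + t * φ b) = -((φ a - φ b) * (s - t)) := by ring
  rw [e, abs_neg, abs_mul, ← mul_assoc]
  exact mul_le_mul_of_nonneg_right (h a b hab) (abs_nonneg _)

open Classical in
/-- The indicator function of the component of `b` in the complement of the open edge `ab`. -/
def sideVertex (T : GTree.{u, v} G) (a b : T.V) (c : T.V) : ℝ :=
  if T.graph.dist b c < T.graph.dist a c then 1 else 0

/-- The projection of the tree to the edge `ab`, identified with `[0, 1]`. -/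
def side (T : GTree.{u, v} G) (a b : T.V) : T.Realization → ℝ := affineExt (T.sideVertex a b)

theorem sideVertex_smul (g : G) (a b c : T.V) :
    T.sideVertex (g • a) (g • b) (g • c) = T.sideVertex a b c := by
  simp only [sideVertex, T.dist_smul]

theorem side_smul (g : G) (a b : T.V) (x : T.Realization) :
    T.side (g • a) (g • b) (g • x) = T.side a b x := by
  rw [side, affineExt_smul]
  simp only [sideVertex_smul]
  rfl

theorem sideVertex_eq_zero_or_one (a b c : T.V) :
    T.sideVertex a b c = 0 ∨ T.sideVertex a b c = 1 := by
  unfold sideVertex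
  split_ifs <;> simp

theorem sideVertex_left (a b : T.V) : T.sideVertex a b a = 0 := by
  simp [sideVertex]

theorem sideVertex_right {a b : T.V} (h : T.graph.Adj a b) : T.sideVertex a b b = 1 := by
  rw [sideVertex, if_pos]
  rw [SimpleGraph.dist_self]
  exact T.isTree.connected.pos_dist_of_ne h.ne

theorem eq_of_sideVertex {a b c d : T.V} (hab : T.graph.Adj a b) (hcd : T.graph.Adj c d)
    (hc : T.sideVertex a b c = 1) (hd : T.sideVertex a b d = 0) : c = b ∧ d = a := by
  apply T.isTree.eq_of_separated hab hcd
  · by_contra h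
    rw [sideVertex, if_neg h] at hc
    exact zero_ne_one hc
  · intro h
    rw [sideVertex, if_pos h] at hd
    exact one_ne_zero hd

/-- Only the edge `ab` crosses between its two sides, so the projection is constant on every other
edge. This gives both its Lipschitz constant and its injectivity over the open edge. -/
theorem sideVertex_cases {a b c d : T.V} (hab : T.graph.Adj a b) (hcd : T.graph.Adj c d) :
    T.sideVertex a b c = T.sideVertex a b d ∨ (c = a ∧ d = b) ∨ (c = b ∧ d = a) := by
  rcases T.sideVertex_eq_zero_or_one a b c with hc | hc <;>
    rcases T.sideVertex_eq_zero_or_one a b d with hd | hd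
  · exact Or.inl (hc.trans hd.symm)
  · exact Or.inr (Or.inl (eq_of_sideVertex hab hcd.symm hd hc).symm)
  · exact Or.inr (Or.inr (eq_of_sideVertex hab hcd hc hd))
  · exact Or.inl (hc.trans hd.symm)

theorem lipschitzWith_side {a b : T.V} (hab : T.graph.Adj a b) :
    LipschitzWith (T.len s(a, b))⁻¹.toNNReal (T.side a b) := by
  have hl := T.len_pos a b hab
  apply lipschitzWith_affineExt
  intro c d hcd
  rw [Real.coe_toNNReal _ (inv_nonneg.2 hl.le)]
  rcases sideVertex_cases hab hcd with h | ⟨rfl, rfl⟩ | ⟨rfl, rfl⟩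
  · rw [h, sub_self, abs_zero]
    exact mul_nonneg (inv_nonneg.2 hl.le) (T.len_pos c d hcd).le
  · rw [inv_mul_cancel₀ hl.ne', sideVertex_left, sideVertex_right hab]
    norm_num
  · rw [Sym2.eq_swap (a := c), inv_mul_cancel₀ hl.ne', sideVertex_left, sideVertex_right hab]
    norm_num

theorem side_of_val {a b : T.V} (hab : T.graph.Adj a b) {x : T.Realization} {s : ℝ}
    (hx : x.1 = bary a b s) : T.side a b x = s := by
  rw [side, affineExt_of_val _ hx, sideVertex_left, sideVertex_right hab]
  ring

/-- The points that are projected to the interior of the edge `ab` are on this edge. -/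
theorem val_eq_of_side {a b : T.V} (hab : T.graph.Adj a b) {x : T.Realization}
    (h : T.side a b x ∈ Set.Ioo (0 : ℝ) 1) : x.1 = bary a b (T.side a b x) := by
  obtain ⟨c, d, hcd | hcd, s, hs, hx⟩ := x.2
  · subst hcd
    rw [side, affineExt_of_val _ hx] at h
    exfalso
    obtain ⟨h0, h1⟩ := h
    rcases T.sideVertex_eq_zero_or_one a b c with hc | hc <;> rw [hc] at h0 h1 <;> linarith
  · rcases sideVertex_cases hab hcd with h' | ⟨rfl, rfl⟩ | ⟨rfl, rfl⟩
    · rw [side, affineExt_of_val _ hx, h'] at h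
      exfalso
      obtain ⟨h0, h1⟩ := h
      rcases T.sideVertex_eq_zero_or_one a b d with hc | hc <;> rw [hc] at h0 h1 <;> linarith
    · rw [side_of_val hab hx, hx]
    · have hx' : x.1 = bary d c (1 - s) := by rw [hx, bary_swap]
      rw [side_of_val hab hx', hx']

/-- In a minimal tree every orbit meets both sides of every edge. -/
theorem exists_side_smul_eq_one (hT : T.IsMinimal) {a b : T.V} (hab : T.graph.Adj a b)
    (x : T.Realization) : ∃ g : G, T.side a b (g • x) = 1 := by
  by_contra! hx
  -- The vertices whose whole orbit stays on the side of `a` will form an invariant subtree missing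
  -- `b`, against minimality.
  have hSne : {c : T.V | ∀ g : G, T.sideVertex a b (g • c) = 0}.Nonempty := by
    have h01 : ∀ c, (¬ ∀ g : G, T.sideVertex a b (g • c) = 0) →
        ∃ g : G, T.sideVertex a b (g • c) = 1 := by
      intro c hc
      push Not at hc
      obtain ⟨g, hg⟩ := hc
      exact ⟨g, (T.sideVertex_eq_zero_or_one a b _).resolve_left hg⟩
    obtain ⟨c, d, hcd | hcd, s, hs, hxs⟩ := x.2
    · subst hcd
      refine ⟨c, fun g => (T.sideVertex_eq_zero_or_one a b _).resolve_right fun h => hx g ?_⟩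
      rw [side, affineExt_smul, affineExt_of_val _ hxs, h]
      ring
    -- If both ends of the edge `cd` carrying `x` had translates beyond `ab`, then, as no translate
    -- of `x` projects to 1, some `g` would send (c, d) to (b, a) and some `k` would send it to (a,
    -- b). Then `g⁻¹ * k` inverts `cd`.
    · by_contra hempty
      obtain ⟨g, hg⟩ := h01 c fun h => hempty ⟨c, h⟩
      obtain ⟨k, hk⟩ := h01 d fun h => hempty ⟨d, h⟩
      have hxg := hx g
      have hxk := hx k
      rw [side, affineExt_smul, affineExt_of_val _ hxs] at hxg hxk
      simp only [hg, hk] at hxg hxk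
      have hg0 : T.sideVertex a b (g • d) = 0 :=
        (T.sideVertex_eq_zero_or_one a b _).resolve_right fun h => hxg (by rw [h]; ring)
      have hk0 : T.sideVertex a b (k • c) = 0 :=
        (T.sideVertex_eq_zero_or_one a b _).resolve_right fun h => hxk (by rw [h]; ring)
      obtain ⟨h1, h2⟩ := eq_of_sideVertex hab (T.adj_smul g _ _ hcd) hg hg0
      obtain ⟨h3, h4⟩ := eq_of_sideVertex hab (T.adj_smul k _ _ hcd.symm) hk hk0
      refine T.no_inversion (g⁻¹ * k) c d hcd ⟨?_, ?_⟩
      · rw [mul_smul, h4, ← h2, inv_smul_smul]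
      · rw [mul_smul, h3, ← h1, inv_smul_smul]
  have hS := hT {c : T.V | ∀ g : G, T.sideVertex a b (g • c) = 0}
    (fun g c hc k => by rw [← mul_smul]; exact hc _)
    -- If `g • w` crossed over, then g • c = a and g • w = b; as `w` is nearer to `d` than `c` is,
    -- `g • d` would lie on the side of `b`.
    (T.isTree.connected_induce _ hSne fun c hc d hd w hw hwd g =>
      (T.sideVertex_eq_zero_or_one a b _).resolve_right fun h => by
        obtain ⟨h1, h2⟩ := eq_of_sideVertex hab (T.adj_smul g _ _ hw.symm) h (hc g)
        have h3 := hd g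
        rw [sideVertex, if_pos] at h3
        · exact one_ne_zero h3
        · rw [← h1, ← h2, T.dist_smul, T.dist_smul]
          omega)
  have hb : b ∈ {c : T.V | ∀ g : G, T.sideVertex a b (g • c) = 0} := hS ▸ Set.mem_univ b
  have := hb 1
  rw [one_smul, sideVertex_right hab] at this
  exact one_ne_zero this

theorem sideVertex_symm {a b : T.V} (hab : T.graph.Adj a b) (c : T.V) :
    T.sideVertex b a c = 1 - T.sideVertex a b c := by
  have := T.isTree.dist_adj_cases' c hab
  unfold sideVertex
  split_ifs <;> first | omega | norm_num

theorem side_symm {a b : T.V} (hab : T.graph.Adj a b) (x : T.Realization) :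
    T.side b a x = 1 - T.side a b x := by
  obtain ⟨c, d, -, s, hs, hx⟩ := x.2
  rw [side, side, affineExt_of_val _ hx, affineExt_of_val _ hx, sideVertex_symm hab,
    sideVertex_symm hab]
  ring

/-- An equivariant continuous map to a minimal tree is onto the open edges. -/
theorem exists_side_eq (hT' : T'.IsMinimal) {f : T.Realization → T'.Realization}
    (hf : Continuous f) (hfG : ∀ (g : G) (x : T.Realization), f (g • x) = g • f x) {a b : T'.V}
    (hab : T'.graph.Adj a b) {s : ℝ} (hs : s ∈ Set.Icc (0 : ℝ) 1) :
    ∃ x, T'.side a b (f x) = s := by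
  obtain ⟨w⟩ := T.isTree.connected.nonempty
  obtain ⟨g, hg⟩ := exists_side_smul_eq_one hT' hab (f (T.vertexPt w))
  obtain ⟨k, hk⟩ := exists_side_smul_eq_one hT' hab.symm (f (T.vertexPt w))
  rw [side_symm hab] at hk
  have := mem_range_of_exists_le_of_exists_ge (c := s)
    ((lipschitzWith_side hab).continuous.comp hf)
    ⟨k • T.vertexPt w, by simp only [Function.comp, hfG]; linarith [hs.1]⟩
    ⟨g • T.vertexPt w, by simp only [Function.comp, hfG]; linarith [hs.2]⟩
  exact this

theorem exists_quotientEdge_rep (T : GTree.{u, v} G) (q : T.QuotientEdge) :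
    ∃ (a b : T.V) (h : T.graph.Adj a b),
      (Quotient.mk'' (⟨s(a, b), h⟩ : T.graph.edgeSet) : T.QuotientEdge) = q ∧
      T.quotientLen q = T.len s(a, b) := by
  induction q using Quotient.inductionOn' with
  | h e =>
    obtain ⟨e, he⟩ := e
    induction e using Sym2.ind with
    | _ a b => exact ⟨a, b, he, rfl, rfl⟩

theorem quotientEdge_mk_eq {a b c d : T.V} (h : T.graph.Adj a b) (h' : T.graph.Adj c d) :
    (Quotient.mk'' (⟨s(a, b), h⟩ : T.graph.edgeSet) : T.QuotientEdge) =
      Quotient.mk'' (⟨s(c, d), h'⟩ : T.graph.edgeSet) ↔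
      ∃ g : G, s(g • c, g • d) = s(a, b) := by
  rw [Quotient.eq'']
  change (⟨s(a, b), h⟩ : T.graph.edgeSet) ∈ MulAction.orbit G (⟨s(c, d), h'⟩ : T.graph.edgeSet) ↔ _
  constructor
  · rintro ⟨g, hg⟩
    exact ⟨g, congrArg Subtype.val hg⟩
  · rintro ⟨g, hg⟩
    exact ⟨g, Subtype.ext hg⟩

theorem bary_injective {V : Type v} {a b c d : V} (hab : a ≠ b) {s t : ℝ}
    (hs : s ∈ Set.Ioo (0 : ℝ) 1) (h : bary a b s = bary c d t) : s(a, b) = s(c, d) := by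
  have h1 : a = c ∨ a = d := by
    by_contra hcon
    push Not at hcon
    have := bary_apply_of_ne (a := c) (b := d) (c := a) hcon.1.symm hcon.2.symm t
    rw [← h, bary_apply_left hab] at this
    linarith [hs.2]
  have h2 : b = c ∨ b = d := by
    by_contra hcon
    push Not at hcon
    have := bary_apply_of_ne (a := c) (b := d) (c := b) hcon.1.symm hcon.2.symm t
    rw [← h, bary_apply_right hab] at this
    linarith [hs.1]
  rw [Sym2.eq_iff]
  rcases h1 with rfl | rfl <;> rcases h2 with rfl | rfl
  · exact absurd rfl hab
  · exact Or.inl ⟨rfl, rfl⟩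
  · exact Or.inr ⟨rfl, rfl⟩
  · exact absurd rfl hab

end GTree

end

/-! ### Lipschitz maps and the volume of the quotient -/

noncomputable section

open scoped NNReal ENNReal
open MeasureTheory

namespace GTree

variable {G : Type u} [Group G] {T T' : GTree.{u, v} G}

/-- Lebesgue measure on the line is one-dimensional Hausdorff measure, which a `C`-Lipschitz map
scales by at most `C`. -/
theorem volume_image_le {C : ℝ≥0} {φ : ℝ → ℝ} (h : LipschitzWith C φ) (s : Set ℝ) :
    volume (φ '' s) ≤ C * volume s := by
  have := h.hausdorffMeasure_image_le (d := 1) zero_le_one s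
  rwa [hausdorffMeasure_real, ENNReal.rpow_one] at this

/-- As there are no inversions, an edge of the orbit of `ab` has a well-defined orientation. -/
theorem smul_prod_eq_of_edge_eq {a b : T.V} (hab : T.graph.Adj a b) {g k : G}
    (e : s(g • a, g • b) = s(k • a, k • b)) : (g • a, g • b) = (k • a, k • b) := by
  rw [Sym2.eq_iff] at e
  rcases e with ⟨h3, h4⟩ | ⟨h3, h4⟩
  · rw [h3, h4]
  · exfalso
    refine T.no_inversion (g⁻¹ * k) _ _ hab ⟨?_, ?_⟩
    · rw [mul_smul, ← h4, inv_smul_smul]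
    · rw [mul_smul, ← h3, inv_smul_smul]

/-- Every point is the translate of a point of one of the representatives of the edges. -/
theorem exists_eq_smul_edgePt [Nontrivial T.V] (a b : T.QuotientEdge → T.V)
    (hab : ∀ q, T.graph.Adj (a q) (b q))
    (hq : ∀ q, (Quotient.mk'' (⟨s(a q, b q), hab q⟩ : T.graph.edgeSet) : T.QuotientEdge) = q)
    (x : T.Realization) :
    ∃ (q : T.QuotientEdge) (g : G), ∃ t ∈ Set.Icc (0 : ℝ) 1, x = g • edgePt (hab q) t := by
  obtain ⟨c, d, hcd, t, ht, rfl⟩ : ∃ (c d : T.V) (h : T.graph.Adj c d),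
      ∃ t ∈ Set.Icc (0 : ℝ) 1, x = edgePt h t := by
    rcases x.cases_on_edge with ⟨c, rfl⟩ | h
    · obtain ⟨d, hd⟩ := T.exists_adj c
      exact ⟨c, d, hd, 0, ⟨le_rfl, zero_le_one⟩, (edgePt_zero hd).symm⟩
    · exact h
  have hrep := hq (Quotient.mk'' ⟨s(c, d), hcd⟩)
  rw [Eq.comm, quotientEdge_mk_eq hcd (hab _)] at hrep
  obtain ⟨g, hg⟩ := hrep
  rw [Sym2.eq_iff] at hg
  rcases hg with ⟨h1, h2⟩ | ⟨h1, h2⟩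
  · refine ⟨Quotient.mk'' ⟨s(c, d), hcd⟩, g, t, ht, Subtype.ext ?_⟩
    rw [smul_edgePt, edgePt_val _ ht, edgePt_val _ ht, h1, h2]
  · have ht' : 1 - t ∈ Set.Icc (0 : ℝ) 1 := ⟨by linarith [ht.2], by linarith [ht.1]⟩
    refine ⟨Quotient.mk'' ⟨s(c, d), hcd⟩, g, 1 - t, ht', Subtype.ext ?_⟩
    rw [smul_edgePt, edgePt_val _ ht, edgePt_val _ ht', h1, h2, bary_swap]

/-- An equivariant `K`-Lipschitz map to a minimal tree increases the volume of the quotient by a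
factor of at most `K`. -/
theorem vol_le_of_lipschitzWith [Countable G] [Nontrivial T.V] [Finite T.QuotientEdge]
    [Finite T'.QuotientEdge] (hT' : T'.IsMinimal) {f : T.Realization → T'.Realization}
    (hfG : ∀ (g : G) (x : T.Realization), f (g • x) = g • f x) {K : ℝ≥0} (hf : LipschitzWith K f) :
    T'.vol ≤ K * T.vol := by
  have := Fintype.ofFinite T.QuotientEdge
  have := Fintype.ofFinite T'.QuotientEdge
  choose a b hab hq hlen using T.exists_quotientEdge_rep
  choose a' b' hab' hq' hlen' using T'.exists_quotientEdge_rep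
  -- the oriented edges in the orbit of a representative
  let O : T'.QuotientEdge → Set (T'.V × T'.V) := fun q' =>
    Set.range fun g : G => (g • a' q', g • b' q')
  have hOadj : ∀ q' (o : O q'), T'.graph.Adj o.1.1 o.1.2 := by
    rintro q' ⟨_, g, rfl⟩
    exact T'.adj_smul g _ _ (hab' q')
  have hOlen : ∀ q' (o : O q'), T'.len s(o.1.1, o.1.2) = T'.quotientLen q' := by
    rintro q' ⟨_, g, rfl⟩
    rw [hlen']
    exact T'.len_smul g _ _ (hab' q')
  have hOcount : ∀ q', Countable (O q') := fun q' => (Set.countable_range _).to_subtype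
  -- `A q o` consists of the parameters on the edge `q` that `f` sends into the open edge `o`.
  -- Indexing by edges `o` of the orbit, and not by group elements, counts each edge once despite
  -- its stabilizer. For fixed `q` these sets are disjoint in [0, 1]; for fixed `q'` their images
  -- under `ψ` cover (0, 1).
  let ψ : T.QuotientEdge → T'.V × T'.V → ℝ → ℝ := fun q o t => T'.side o.1 o.2 (f (edgePt (hab q) t))
  let A : T.QuotientEdge → T'.V × T'.V → Set ℝ := fun q o =>
    Set.Icc 0 1 ∩ ψ q o ⁻¹' (Set.Ioo 0 1)
  have hψ : ∀ q q' (o : O q'), LipschitzWith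
      ((T'.quotientLen q')⁻¹.toNNReal * (K * (T.quotientLen q).toNNReal)) (ψ q o.1) := by
    intro q q' o
    have h1 := lipschitzWith_side (hOadj q' o)
    have h2 := lipschitzWith_edgePt (hab q)
    rw [hOlen] at h1
    rw [← hlen] at h2
    exact h1.comp (hf.comp h2)
  have hAmeas : ∀ q q' (o : O q'), MeasurableSet (A q o.1) := fun q q' o =>
    measurableSet_Icc.inter ((hψ q q' o).continuous.measurable measurableSet_Ioo)
  have hAdisj : ∀ q, Pairwise (Function.onFun Disjoint
      fun j : (Σ q', O q') => A q j.2.1) := by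
    rintro q ⟨q₁, o₁⟩ ⟨q₂, o₂⟩ hne
    rw [Function.onFun, Set.disjoint_left]
    rintro t ⟨-, h1⟩ ⟨-, h2⟩
    apply hne
    have e1 := val_eq_of_side (hOadj q₁ o₁) h1
    have e2 := val_eq_of_side (hOadj q₂ o₂) h2
    have e := bary_injective (hOadj q₁ o₁).ne h1 (e1.symm.trans e2)
    obtain ⟨_, g₁, rfl⟩ := o₁
    obtain ⟨_, g₂, rfl⟩ := o₂
    simp only at e
    have hqq : q₁ = q₂ := by
      rw [← hq' q₁, ← hq' q₂, quotientEdge_mk_eq]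
      refine ⟨g₁⁻¹ * g₂, ?_⟩
      have := congrArg (Sym2.map fun x => g₁⁻¹ • x) e
      simp only [Sym2.map_mk, inv_smul_smul] at this
      rw [mul_smul, mul_smul, this]
    subst hqq
    have h3 := smul_prod_eq_of_edge_eq (hab' q₁) e
    exact congrArg (Sigma.mk q₁) (Subtype.ext h3)
  have hsum : ∀ q, ∑' j : (Σ q', O q'), volume (A q j.2.1) ≤ 1 := by
    intro q
    have h1 := tsum_meas_le_meas_iUnion_of_disjoint (ι := Σ q', O q')
      (As := fun j => A q j.2.1) volume (fun j => hAmeas q j.1 j.2) (hAdisj q)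
    have h2 : (⋃ j : (Σ q', O q'), A q j.2.1) ⊆ Set.Icc (0 : ℝ) 1 :=
      Set.iUnion_subset fun j => Set.inter_subset_left
    have h3 := measure_mono (μ := volume) h2
    rw [Real.volume_Icc, sub_zero, ENNReal.ofReal_one] at h3
    exact h1.trans h3
  have hcover : ∀ q', Set.Ioo (0 : ℝ) 1 ⊆ ⋃ q, ⋃ o : O q', ψ q o.1 '' A q o.1 := by
    intro q' s hs
    obtain ⟨x, hx⟩ := exists_side_eq hT' hf.continuous hfG (hab' q') ⟨hs.1.le, hs.2.le⟩
    obtain ⟨q, g, t', ht', hxt⟩ := exists_eq_smul_edgePt a b hab hq x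
    rw [hxt, hfG] at hx
    have hψs : ψ q (g⁻¹ • a' q', g⁻¹ • b' q') t' = s := by
      rw [← hx]
      change T'.side (g⁻¹ • a' q') (g⁻¹ • b' q') (f (edgePt (hab q) t')) = _
      conv_lhs => rw [← inv_smul_smul g (f (edgePt (hab q) t')), side_smul]
    refine Set.mem_iUnion.2 ⟨q, Set.mem_iUnion.2 ⟨⟨_, g⁻¹, rfl⟩, t', ⟨ht', ?_⟩, hψs⟩⟩
    change ψ q (g⁻¹ • a' q', g⁻¹ • b' q') t' ∈ Set.Ioo (0 : ℝ) 1
    rw [hψs]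
    exact hs
  -- In unit parameters `ψ q o` has Lipschitz constant K len(q) / len(q'), so multiplying by len(q')
  -- clears the denominator. Countability of the orbit is needed for subadditivity of the measure.
  have hbound : ∀ q', ENNReal.ofReal (T'.quotientLen q') ≤
      ∑ q, ∑' o : O q', (K * ENNReal.ofReal (T.quotientLen q)) * volume (A q o.1) := by
    intro q'
    have hpos := T'.quotientLen_pos q'
    have h1 : (1 : ℝ≥0∞) ≤ ∑ q, ∑' o : O q', volume (ψ q o.1 '' A q o.1) := by
      have := measure_mono (μ := volume) (hcover q')
      rw [Real.volume_Ioo, sub_zero, ENNReal.ofReal_one] at this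
      refine this.trans ((measure_iUnion_le _).trans ?_)
      rw [tsum_fintype]
      exact Finset.sum_le_sum fun q _ => measure_iUnion_le _
    calc ENNReal.ofReal (T'.quotientLen q')
        ≤ ENNReal.ofReal (T'.quotientLen q') * ∑ q, ∑' o : O q', volume (ψ q o.1 '' A q o.1) :=
          le_mul_of_one_le_right zero_le h1
      _ = ∑ q, ∑' o : O q', ENNReal.ofReal (T'.quotientLen q') * volume (ψ q o.1 '' A q o.1) := by
          rw [Finset.mul_sum]
          simp only [ENNReal.tsum_mul_left]
      _ ≤ _ := by
          refine Finset.sum_le_sum fun q _ => ENNReal.tsum_le_tsum fun o => ?_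
          refine (mul_le_mul_right (volume_image_le (hψ q q' o) (A q o.1)) _).trans ?_
          rw [← mul_assoc]
          refine mul_le_mul_left ?_ _
          rw [ENNReal.coe_mul, ENNReal.coe_mul, ← mul_assoc]
          change _ * ENNReal.ofReal _ * _ ≤ _ * ENNReal.ofReal _
          rw [← ENNReal.ofReal_mul hpos.le, mul_inv_cancel₀ hpos.ne', ENNReal.ofReal_one, one_mul]
          rfl
  -- After exchanging the sums, the sets `A q o` attached to one edge `q` have total measure at most
  -- 1.
  have hfinal : ∑ q', ENNReal.ofReal (T'.quotientLen q') ≤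
      K * ∑ q, ENNReal.ofReal (T.quotientLen q) := by
    refine (Finset.sum_le_sum fun q' _ => hbound q').trans ?_
    rw [Finset.sum_comm, Finset.mul_sum]
    refine Finset.sum_le_sum fun q _ => ?_
    have := hsum q
    rw [ENNReal.tsum_sigma', tsum_fintype] at this
    simp only [ENNReal.tsum_mul_left]
    rw [← Finset.mul_sum]
    exact mul_le_of_le_one_right zero_le this
  have hT0 : ∀ q ∈ (Finset.univ : Finset T.QuotientEdge), 0 ≤ T.quotientLen q :=
    fun q _ => (T.quotientLen_pos q).le
  have hT'0 : ∀ q ∈ (Finset.univ : Finset T'.QuotientEdge), 0 ≤ T'.quotientLen q :=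
    fun q _ => (T'.quotientLen_pos q).le
  rw [← ENNReal.ofReal_sum_of_nonneg hT'0, ← ENNReal.ofReal_sum_of_nonneg hT0,
    ← ENNReal.ofReal_coe_nnreal, ← ENNReal.ofReal_mul K.coe_nonneg,
    ENNReal.ofReal_le_ofReal_iff (mul_nonneg K.coe_nonneg (Finset.sum_nonneg hT0))] at hfinal
  rwa [vol, vol, finsum_eq_sum_of_fintype, finsum_eq_sum_of_fintype]

end GTree

end

/-! ### Extending equivariant vertex maps along geodesics -/

noncomputable section

open scoped NNReal ENNReal

/-- The tent function. -/
def tent (x : ℝ) : ℝ := max 0 (1 - |x|)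

theorem tent_of_nonneg {x : ℝ} (h0 : 0 ≤ x) (h1 : x ≤ 1) : tent x = 1 - x := by
  rw [tent, abs_of_nonneg h0, max_eq_right (by linarith)]

theorem tent_neg (x : ℝ) : tent (-x) = tent x := by
  rw [tent, tent, abs_neg]

theorem tent_of_one_le {x : ℝ} (h : 1 ≤ |x|) : tent x = 0 := by
  rw [tent, max_eq_left (by linarith)]

namespace GTree

variable {G : Type u} [Group G] {T T' : GTree.{u, v} G}

/-- The path between two vertices. -/
def geodesic (T : GTree.{u, v} G) (a b : T.V) : T.graph.Walk a b :=
  (T.isTree.existsUnique_path a b).choose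

theorem isPath_geodesic (a b : T.V) : (T.geodesic a b).IsPath :=
  (T.isTree.existsUnique_path a b).choose_spec.1

theorem geodesic_eq {a b : T.V} {p : T.graph.Walk a b} (hp : p.IsPath) : p = T.geodesic a b :=
  (T.isTree.existsUnique_path a b).unique hp (isPath_geodesic a b)

theorem length_geodesic (a b : T.V) : (T.geodesic a b).length = T.graph.dist a b :=
  T.isTree.length_eq_dist _ (isPath_geodesic a b)

/-- The vertices along the path from `a` to `b`. -/
def geoVert (T : GTree.{u, v} G) (a b : T.V) (i : ℕ) : T.V := (T.geodesic a b).getVert i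

theorem geoVert_zero (a b : T.V) : T.geoVert a b 0 = a := (T.geodesic a b).getVert_zero

theorem geoVert_adj {a b : T.V} {i : ℕ} (hi : i < T.graph.dist a b) :
    T.graph.Adj (T.geoVert a b i) (T.geoVert a b (i + 1)) :=
  (T.geodesic a b).adj_getVert_succ (by rwa [length_geodesic])

theorem geoVert_symm (a b : T.V) (i : ℕ) :
    T.geoVert b a i = T.geoVert a b (T.graph.dist a b - i) := by
  rw [geoVert, geoVert, ← geodesic_eq (isPath_geodesic a b).reverse,
    SimpleGraph.Walk.getVert_reverse, length_geodesic]

theorem geoVert_smul (g : G) (a b : T.V) (i : ℕ) :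
    T.geoVert (g • a) (g • b) i = g • T.geoVert a b i := by
  let φ : T.graph →g T.graph := ⟨fun x => g • x, fun {x y} h => T.adj_smul g x y h⟩
  have h := geodesic_eq (T := T)
    (SimpleGraph.Walk.IsPath.map (f := φ) (MulAction.injective g)
      (isPath_geodesic a b))
  have h' : ((T.geodesic a b).map φ).getVert i = T.geoVert (g • a) (g • b) i := by
    rw [h]; rfl
  rw [← h', SimpleGraph.Walk.getVert_map]
  rfl

/-- The barycentric coordinates of the point at combinatorial distance `t` from `a` on the path
from `a` to `b`. -/
def seg (T : GTree.{u, v} G) (a b : T.V) (t : ℝ) : T.V →₀ ℝ :=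
  ∑ i ∈ Finset.range (T.graph.dist a b + 1), Finsupp.single (T.geoVert a b i) (tent (t - i))

/-- Between two consecutive integers only the two tents centred there are nonzero. Writing `seg` as
a sum of tents makes reversal and equivariance termwise. -/
theorem seg_eq_bary {a b : T.V} {i : ℕ} (hi : i < T.graph.dist a b) {t : ℝ} (h0 : (i : ℝ) ≤ t)
    (h1 : t ≤ i + 1) : T.seg a b t = bary (T.geoVert a b i) (T.geoVert a b (i + 1)) (t - i) := by
  rw [seg, Finset.sum_eq_add i (i + 1) (by omega)]
  · rw [bary, tent_of_nonneg (by linarith) (by linarith), ← tent_neg (t - _),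
      tent_of_nonneg (by push_cast; linarith) (by push_cast; linarith)]
    congr 2
    push_cast
    ring
  · rintro j - ⟨hj1, hj2⟩
    rw [tent_of_one_le, Finsupp.single_zero]
    rcases lt_or_gt_of_ne hj1 with hj | hj
    · have : (j : ℝ) + 1 ≤ i := by exact_mod_cast hj
      exact le_trans (by linarith) (le_abs_self _)
    · have : (i : ℝ) + 1 + 1 ≤ j := by
        have : i + 1 + 1 ≤ j := by omega
        exact_mod_cast this
      exact le_trans (by linarith) (neg_le_abs _)
  · intro h; exact absurd (Finset.mem_range.2 (by omega)) h
  · intro h; exact absurd (Finset.mem_range.2 (by omega)) h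

theorem seg_self (a : T.V) : T.seg a a 0 = Finsupp.single a 1 := by
  simp [seg, geoVert_zero, tent]

theorem seg_zero (a b : T.V) : T.seg a b 0 = Finsupp.single a 1 := by
  rcases eq_or_ne a b with rfl | h
  · exact seg_self a
  · have := T.isTree.connected.pos_dist_of_ne h
    rw [seg_eq_bary this (by simp) (by simp), Nat.cast_zero, sub_zero, bary_zero, geoVert_zero]

theorem seg_symm (a b : T.V) (t : ℝ) : T.seg b a (T.graph.dist a b - t) = T.seg a b t := by
  rw [seg, seg, SimpleGraph.dist_comm (u := b), ← Finset.sum_range_reflect]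
  refine Finset.sum_congr rfl fun i hi => ?_
  have hi' : i ≤ T.graph.dist a b := by
    have := Finset.mem_range.1 hi
    omega
  rw [geoVert_symm, show T.graph.dist a b + 1 - 1 - i = T.graph.dist a b - i by omega,
    Nat.sub_sub_self hi', Nat.cast_sub hi', ← tent_neg]
  congr 2
  ring

theorem seg_dist (a b : T.V) : T.seg a b (T.graph.dist a b) = Finsupp.single b 1 := by
  rw [← seg_symm, sub_self, seg_zero]

theorem seg_smul (g : G) (a b : T.V) (t : ℝ) :
    T.seg (g • a) (g • b) t = Finsupp.mapDomain (fun x => g • x) (T.seg a b t) := by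
  rw [seg, seg, T.dist_smul, Finsupp.mapDomain_finsetSum]
  refine Finset.sum_congr rfl fun i _ => ?_
  rw [geoVert_smul, Finsupp.mapDomain_single]

theorem exists_nat_le_lt {n : ℕ} (hn : 0 < n) {t : ℝ} (h0 : 0 ≤ t) (h1 : t ≤ n) :
    ∃ i < n, (i : ℝ) ≤ t ∧ t ≤ i + 1 := by
  rcases h1.lt_or_eq with h | h
  · exact ⟨⌊t⌋₊, (Nat.floor_lt h0).2 h, Nat.floor_le h0, (Nat.lt_floor_add_one t).le⟩
  · refine ⟨n - 1, by omega, ?_⟩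
    rw [Nat.cast_sub (by omega : 1 ≤ n), h]
    constructor <;> push_cast <;> linarith

theorem seg_mem {a b : T.V} {t : ℝ} (h0 : 0 ≤ t) (h1 : t ≤ T.graph.dist a b) :
    ∃ c d : T.V, (c = d ∨ T.graph.Adj c d) ∧ ∃ s ∈ Set.Icc (0 : ℝ) 1, T.seg a b t = bary c d s := by
  rcases eq_or_ne a b with rfl | h
  · rw [SimpleGraph.dist_self, Nat.cast_zero] at h1
    rw [le_antisymm h1 h0, seg_self]
    exact ⟨a, a, Or.inl rfl, 0, ⟨le_rfl, zero_le_one⟩, (bary_zero a a).symm⟩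
  · obtain ⟨i, hi, hi0, hi1⟩ :=
      exists_nat_le_lt (T.isTree.connected.pos_dist_of_ne h) h0 h1
    exact ⟨_, _, Or.inr (geoVert_adj hi), t - i, ⟨by linarith, by linarith⟩,
      seg_eq_bary hi hi0 hi1⟩

theorem len_le_vol (T : GTree.{u, v} G) [Finite T.QuotientEdge] {a b : T.V}
    (h : T.graph.Adj a b) : T.len s(a, b) ≤ T.vol := by
  have := Fintype.ofFinite T.QuotientEdge
  rw [vol, finsum_eq_sum_of_fintype]
  exact Finset.single_le_sum (f := T.quotientLen) (fun q _ => (T.quotientLen_pos q).le)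
    (Finset.mem_univ (Quotient.mk'' ⟨s(a, b), h⟩))

/-- A crude bound on speed suffices: no edge is longer than the volume of the quotient. -/
theorem edist_seg_le [Finite T.QuotientEdge] {a b : T.V} {x y : T.Realization} {s t : ℝ}
    (h0 : 0 ≤ s) (hst : s ≤ t) (h1 : t ≤ T.graph.dist a b) (hx : x.1 = T.seg a b s)
    (hy : y.1 = T.seg a b t) : edist x y ≤ ENNReal.ofReal (T.vol * (t - s)) := by
  have hvol : 0 ≤ T.vol := by
    have := Fintype.ofFinite T.QuotientEdge
    rw [vol, finsum_eq_sum_of_fintype]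
    exact Finset.sum_nonneg fun q _ => (T.quotientLen_pos q).le
  have piece : ∀ (i : ℕ), i < T.graph.dist a b → ∀ (s t : ℝ) (x y : T.Realization), (i : ℝ) ≤ s →
      s ≤ t → t ≤ i + 1 → x.1 = T.seg a b s → y.1 = T.seg a b t →
      edist x y ≤ ENNReal.ofReal (T.vol * (t - s)) := by
    intro i hi s t x y his hst hti hx hy
    rw [seg_eq_bary hi his (by linarith)] at hx
    rw [seg_eq_bary hi (by linarith) hti] at hy
    have hadj := geoVert_adj hi
    have := edist_le_of_pathLen (PathLen.cons _ _ hadj ⟨_, ⟨by linarith, by linarith⟩, hx⟩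
      ⟨_, ⟨by linarith, by linarith⟩, hy⟩ (PathLen.nil y))
    refine this.trans (ENNReal.ofReal_le_ofReal ?_)
    rw [add_zero, hx, hy, bary_apply_right hadj.ne, bary_apply_right hadj.ne, abs_sub_comm,
      abs_of_nonneg (by linarith), sub_sub_sub_cancel_right]
    exact mul_le_mul_of_nonneg_right (T.len_le_vol hadj) (by linarith)
  have key : ∀ (i : ℕ), i < T.graph.dist a b → ∀ (t : ℝ) (y : T.Realization), (i : ℝ) ≤ t →
      t ≤ i + 1 → s ≤ t → y.1 = T.seg a b t → edist x y ≤ ENNReal.ofReal (T.vol * (t - s)) := by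
    intro i
    induction i with
    | zero =>
      intro hi t y h0t hti hst hy
      exact piece 0 hi s t x y (by simpa using h0) hst hti hx hy
    | succ i ih =>
      intro hi t y h0t hti hst hy
      rcases le_total ((i + 1 : ℕ) : ℝ) s with h | h
      · exact piece (i + 1) hi s t x y h hst hti hx hy
      · have hz : ((i + 1 : ℕ) : ℝ) ≤ T.graph.dist a b := by exact_mod_cast hi.le
        let z : T.Realization := ⟨T.seg a b (i + 1 : ℕ), seg_mem (Nat.cast_nonneg _) hz⟩
        have h2 := ih (by omega) (i + 1 : ℕ) z (by push_cast; linarith) (by push_cast; linarith) h rfl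
        have h3 := piece (i + 1) hi (i + 1 : ℕ) t z y le_rfl h0t hti rfl hy
        refine (edist_triangle x z y).trans ((add_le_add h2 h3).trans ?_)
        rw [← ENNReal.ofReal_add (mul_nonneg hvol (by linarith)) (mul_nonneg hvol (by linarith))]
        apply ENNReal.ofReal_le_ofReal
        linarith
  rcases eq_or_ne a b with rfl | h
  · rw [SimpleGraph.dist_self, Nat.cast_zero] at h1
    have hs : s = 0 := by linarith
    have ht : t = 0 := by linarith
    have : x = y := Subtype.ext (by rw [hx, hy, hs, ht])
    rw [this, edist_self]
    exact zero_le
  · obtain ⟨i, hi, hi0, hi1⟩ :=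
      exists_nat_le_lt (T.isTree.connected.pos_dist_of_ne h) (h0.trans hst) h1
    exact key i hi t y hi0 hi1 hst hy

/-- An equivariant map between the vertices of two trees exists if stabilizers of vertices of the
first fix vertices of the second. -/
theorem exists_equivariant {X Y : Type*} [MulAction G X] [MulAction G Y]
    (h : ∀ x : X, ∃ y : Y, MulAction.stabilizer G x ≤ MulAction.stabilizer G y) :
    ∃ F : X → Y, ∀ (g : G) (x : X), F (g • x) = g • F x := by
  choose y hy using h
  let rep : X → X := fun x => (Quotient.mk'' x : MulAction.orbitRel.Quotient G X).out
  have hrep : ∀ x, ∃ g : G, g • rep x = x := fun x => by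
    have : (MulAction.orbitRel G X) (rep x) x := Quotient.exact (Quotient.out_eq _)
    obtain ⟨g, hg⟩ := (MulAction.orbitRel G X).symm this
    exact ⟨g, hg⟩
  have hrep' : ∀ (g : G) x, rep (g • x) = rep x := fun g x => by
    have : (Quotient.mk'' (g • x) : MulAction.orbitRel.Quotient G X) = Quotient.mk'' x :=
      Quotient.sound' ⟨g, rfl⟩
    simp only [rep, this]
  choose k hk using hrep
  refine ⟨fun x => k x • y (rep x), fun g x => ?_⟩
  -- Two elements carrying the representative to the same point differ by its stabilizer, which
  -- fixes the chosen image.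
  have h1 : (k (g • x))⁻¹ * (g * k x) ∈ MulAction.stabilizer G (rep x) := by
    rw [MulAction.mem_stabilizer_iff, mul_smul, mul_smul, hk, inv_smul_eq_iff, ← hrep' g x, hk]
  have h2 := MulAction.mem_stabilizer_iff.1 (hy _ h1)
  rw [mul_smul, inv_smul_eq_iff, mul_smul] at h2
  simp only [hrep']
  exact h2.symm

/-- An equivariant map between vertices extends to an equivariant Lipschitz map. -/
theorem nonempty_lipMap [Finite T.QuotientEdge] [Finite T'.QuotientEdge] (F : T.V → T'.V)
    (hF : ∀ (g : G) (x : T.V), F (g • x) = g • F x) : Nonempty (LipMap T T') := by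
  let val : T.V → T.V → ℝ → (T'.V →₀ ℝ) := fun a b s =>
    T'.seg (F a) (F b) (T'.graph.dist (F a) (F b) * s)
  have hvertex : ∀ a b s, s ∈ Set.Icc (0 : ℝ) 1 → (a ≠ b ∧ s ∈ Set.Ioo (0 : ℝ) 1) ∨
      ∃ c, bary a b s = Finsupp.single c 1 ∧ val a b s = Finsupp.single (F c) 1 := by
    intro a b s hs
    rcases eq_or_ne a b with rfl | hab
    · refine Or.inr ⟨a, bary_self a s, ?_⟩
      simp only [val, SimpleGraph.dist_self, Nat.cast_zero, zero_mul, seg_self]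
    · rcases hs.1.eq_or_lt with rfl | h0
      · refine Or.inr ⟨a, bary_zero a b, ?_⟩
        simp only [val, mul_zero, seg_zero]
      · rcases hs.2.eq_or_lt with rfl | h1
        · refine Or.inr ⟨b, bary_one a b, ?_⟩
          simp only [val, mul_one, seg_dist]
        · exact Or.inl ⟨hab, h0, h1⟩
  -- A point has several barycentric presentations: an edge can be reversed, and a vertex is an end
  -- of many edges. The image must not depend on the choice.
  have hwd : ∀ a b s c d t, s ∈ Set.Icc (0 : ℝ) 1 → t ∈ Set.Icc (0 : ℝ) 1 →
      bary a b s = bary c d t → val a b s = val c d t := by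
    intro a b s c d t hs ht h
    rcases hvertex a b s hs with ⟨hab, hs'⟩ | ⟨x, hx, hx'⟩
    · rcases hvertex c d t ht with ⟨hcd, ht'⟩ | ⟨x, hx, hx'⟩
      · have h' := bary_injective hab hs' h
        rw [Sym2.eq_iff] at h'
        rcases h' with ⟨rfl, rfl⟩ | ⟨rfl, rfl⟩
        · have : s = t := by rw [← bary_apply_right hab s, h, bary_apply_right hab]
          rw [this]
        · have : s = 1 - t := by rw [← bary_apply_right hab s, h, bary_apply_left hcd]
          simp only [val]
          rw [this, ← seg_symm, SimpleGraph.dist_comm (u := F b)]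
          congr 1
          ring
      · exfalso
        rw [hx, ← bary_self x 0] at h
        have h' := bary_injective hab hs' h
        rw [Sym2.eq_iff] at h'
        rcases h' with ⟨rfl, rfl⟩ | ⟨rfl, rfl⟩ <;> exact hab rfl
    · rcases hvertex c d t ht with ⟨hcd, ht'⟩ | ⟨y, hy, hy'⟩
      · exfalso
        rw [hx, ← bary_self x 0] at h
        have h' := bary_injective hcd ht' h.symm
        rw [Sym2.eq_iff] at h'
        rcases h' with ⟨rfl, rfl⟩ | ⟨rfl, rfl⟩ <;> exact hcd rfl
      · rw [hx, hy] at h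
        rw [hx', hy', Finsupp.single_left_injective one_ne_zero h]
  have hrep : ∀ x : T.Realization, ∃ a b s, s ∈ Set.Icc (0 : ℝ) 1 ∧ x.1 = bary a b s := by
    rintro ⟨x, a, b, -, s, hs, hx⟩
    exact ⟨a, b, s, hs, hx⟩
  choose a b s hs hx using hrep
  have hmem : ∀ {a b : T.V} {s : ℝ}, s ∈ Set.Icc (0 : ℝ) 1 →
      0 ≤ T'.graph.dist (F a) (F b) * s ∧
        T'.graph.dist (F a) (F b) * s ≤ T'.graph.dist (F a) (F b) := fun {a b s} h =>
    ⟨mul_nonneg (Nat.cast_nonneg _) h.1, mul_le_of_le_one_right (Nat.cast_nonneg _) h.2⟩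
  let f : T.Realization → T'.Realization := fun x =>
    ⟨val (a x) (b x) (s x), seg_mem (hmem (hs x)).1 (hmem (hs x)).2⟩
  have hf : ∀ x c d t, t ∈ Set.Icc (0 : ℝ) 1 → x.1 = bary c d t → (f x).1 = val c d t :=
    fun x c d t ht h => hwd _ _ _ _ _ _ (hs x) ht ((hx x).symm.trans h)
  choose a₀ b₀ hab₀ hq₀ hlen₀ using T.exists_quotientEdge_rep
  have := Fintype.ofFinite T.QuotientEdge
  have hvol : 0 ≤ T'.vol := by
    have := Fintype.ofFinite T'.QuotientEdge
    rw [vol, finsum_eq_sum_of_fintype]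
    exact Finset.sum_nonneg fun q _ => (T'.quotientLen_pos q).le
  -- Each term bounds the stretch on one orbit of edges. The sum is a convenient common upper bound.
  let C : ℝ := ∑ q : T.QuotientEdge,
    T'.vol * T'.graph.dist (F (a₀ q)) (F (b₀ q)) / T.quotientLen q
  have hterm : ∀ q ∈ (Finset.univ : Finset T.QuotientEdge),
      0 ≤ T'.vol * T'.graph.dist (F (a₀ q)) (F (b₀ q)) / T.quotientLen q := fun q _ =>
    div_nonneg (mul_nonneg hvol (Nat.cast_nonneg _)) (T.quotientLen_pos q).le
  have hC0 : 0 ≤ C := Finset.sum_nonneg hterm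
  have hC : ∀ c d, T.graph.Adj c d →
      T'.vol * T'.graph.dist (F c) (F d) ≤ C * T.len s(c, d) := by
    intro c d hcd
    set q : T.QuotientEdge := Quotient.mk'' ⟨s(c, d), hcd⟩ with hqdef
    have h1 : T.quotientLen q = T.len s(c, d) := rfl
    have h2 := Finset.single_le_sum hterm (Finset.mem_univ q)
    rw [div_le_iff₀ (T.quotientLen_pos q), h1] at h2
    have hg := hq₀ q
    rw [Eq.comm, hqdef, quotientEdge_mk_eq hcd (hab₀ _)] at hg
    obtain ⟨g, hg⟩ := hg
    rw [← hqdef, Sym2.eq_iff] at hg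
    have h3 : T'.graph.dist (F c) (F d) = T'.graph.dist (F (a₀ q)) (F (b₀ q)) := by
      rcases hg with ⟨h, h'⟩ | ⟨h, h'⟩
      · rw [← h, ← h', hF, hF, T'.dist_smul]
      · rw [← h, ← h', hF, hF, T'.dist_smul, SimpleGraph.dist_comm]
    rwa [h3]
  refine ⟨⟨f, ?_, ⟨C.toNNReal, ?_⟩⟩⟩
  · intro g x
    apply Subtype.ext
    have h1 : (g • x).1 = bary (g • a x) (g • b x) (s x) := by
      rw [smul_val, hx x, mapDomain_bary]
    rw [hf _ _ _ _ (hs x) h1, smul_val, hf x _ _ _ (hs x) (hx x)]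
    simp only [val, hF, T'.dist_smul, seg_smul]
  · apply lipschitzWith_of_edges
    rintro c d hcd x y ⟨p, hp, hxp⟩ ⟨q, hq, hyq⟩
    have hle : ∀ (x y : T.Realization) (p q : ℝ), p ∈ Set.Icc (0 : ℝ) 1 → q ∈ Set.Icc (0 : ℝ) 1 →
        x.1 = bary c d p → y.1 = bary c d q → p ≤ q → edist (f x) (f y) ≤
        (C.toNNReal : ℝ≥0∞) * ENNReal.ofReal (T.len s(c, d) * |x.1 d - y.1 d|) := by
      intro x y p q hp hq hxp hyq hpq
      refine (edist_seg_le (hmem hp).1 (mul_le_mul_of_nonneg_left hpq (Nat.cast_nonneg _))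
        (hmem hq).2 (hf x c d p hp hxp) (hf y c d q hq hyq)).trans ?_
      change _ ≤ ENNReal.ofReal C * _
      rw [← ENNReal.ofReal_mul hC0]
      apply ENNReal.ofReal_le_ofReal
      rw [hxp, hyq, bary_apply_right hcd.ne, bary_apply_right hcd.ne, abs_sub_comm,
        abs_of_nonneg (by linarith), ← mul_sub, ← mul_assoc, ← mul_assoc]
      exact mul_le_mul_of_nonneg_right (hC c d hcd) (by linarith)
    rcases le_total p q with h | h
    · exact hle x y p q hp hq hxp hyq h
    · rw [edist_comm, abs_sub_comm]
      exact hle y x q p hq hp hyq hxp h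

end GTree

end

/-! ### Properties of the Lipschitz metric -/

noncomputable section

open scoped NNReal ENNReal

namespace GTree

variable {G : Type u} [Group G] {T T' T'' : GTree.{u, v} G}

theorem LipMap.const_nonneg (f : LipMap T T') : 0 ≤ f.const := NNReal.coe_nonneg _

theorem LipMap.const_le {f : LipMap T T'} {K : ℝ≥0} (h : LipschitzWith K f.1) : f.const ≤ K :=
  NNReal.coe_le_coe.2 (csInf_le (OrderBot.bddBelow _) h)

/-- The Lipschitz constant of a map is attained. -/
theorem LipMap.exists_lipschitzWith (f : LipMap T T') :
    ∃ K : ℝ≥0, LipschitzWith K f.1 ∧ f.const = K := by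
  refine ⟨_, ?_, rfl⟩
  -- Distances are finite, so each Lipschitz inequality is a closed condition on `K`.
  have hclosed : IsClosed {K : ℝ≥0 | LipschitzWith K f.1} := by
    have e : {K : ℝ≥0 | LipschitzWith K f.1} =
        ⋂ (x : T.Realization) (y : T.Realization),
          {K : ℝ≥0 | edist (f.1 x) (f.1 y) ≤ (K : ℝ≥0∞) * edist x y} := by
      ext K
      simp only [Set.mem_iInter]
      rfl
    rw [e]
    refine isClosed_iInter fun x => isClosed_iInter fun y => isClosed_le continuous_const ?_
    exact (ENNReal.continuous_mul_const (edist_ne_top x y)).comp ENNReal.continuous_coe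
  exact hclosed.csInf_mem f.2.2 (OrderBot.bddBelow _)

theorem lip_nonneg : 0 ≤ Lip T T' := Real.iInf_nonneg fun f => f.const_nonneg

theorem lip_le (f : LipMap T T') : Lip T T' ≤ f.const :=
  ciInf_le ⟨0, by rintro _ ⟨f, rfl⟩; exact f.const_nonneg⟩ f

/-- Lipschitz constants multiply under composition. Nonnegativity of the factors lets both infima be
pulled out of the product. -/
theorem lip_le_mul [Nonempty (LipMap T T')] [Nonempty (LipMap T' T'')] :
    Lip T T'' ≤ Lip T T' * Lip T' T'' := by
  have key : ∀ (f : LipMap T T') (f' : LipMap T' T''), Lip T T'' ≤ f.const * f'.const := by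
    intro f f'
    obtain ⟨K, hK, hf⟩ := f.exists_lipschitzWith
    obtain ⟨K', hK', hf'⟩ := f'.exists_lipschitzWith
    let k : LipMap T T'' := ⟨f'.1 ∘ f.1, fun g x => by
      simp only [Function.comp, f.2.1, f'.2.1], K' * K, hK'.comp hK⟩
    refine (lip_le k).trans ((LipMap.const_le (f := k) (hK'.comp hK)).trans ?_)
    rw [hf, hf', NNReal.coe_mul, mul_comm]
  change _ ≤ (⨅ f : LipMap T T', f.const) * Lip T' T''
  rw [Real.iInf_mul_of_nonneg lip_nonneg]
  refine le_ciInf fun f => ?_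
  change _ ≤ f.const * ⨅ f' : LipMap T' T'', f'.const
  rw [Real.mul_iInf_of_nonneg f.const_nonneg]
  exact le_ciInf fun f' => key f f'

/-- The trees to which the comparison of volumes applies. -/
structure IsTame (T : GTree.{u, v} G) : Prop where
  minimal : T.IsMinimal
  nontrivial : Nontrivial T.V
  finite : Finite T.QuotientEdge

theorem IsTame.vol_pos (hT : T.IsTame) : 0 < T.vol :=
  have := hT.nontrivial
  have := hT.finite
  T.vol_pos

theorem Equivalent.symm (h : Equivalent T T') : Equivalent T' T := by
  obtain ⟨φ, hφ⟩ := h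
  refine ⟨φ.symm, fun g x => ?_⟩
  apply φ.injective
  rw [hφ, DilationEquiv.apply_symm_apply, DilationEquiv.apply_symm_apply]

theorem IsCyclicMinimal.isTame (hG : IsGBS G) (hns : ¬ Group.IsSolvable G)
    (hT : T.IsCyclicMinimal) : T.IsTame :=
  ⟨hT.1, T.nontrivial_of_not_isSolvable hT hns,
    T.finite_quotientEdge hT.1 hG.fg_and_exists_commensurated.1⟩

theorem IsCyclicMinimal.nonempty_lipMap (hG : IsGBS G) (hns : ¬ Group.IsSolvable G)
    (hT : T.IsCyclicMinimal) (hT' : T'.IsCyclicMinimal) : Nonempty (LipMap T T') := by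
  have := (hT.isTame hG hns).finite
  have := (hT'.isTame hG hns).finite
  obtain ⟨F, hF⟩ := exists_equivariant (G := G) (exists_stabilizer_le hG hns T T' hT hT')
  exact GTree.nonempty_lipMap F hF

variable [Countable G]

/-- The volume comparison holds for every admissible map, hence for the infimum. Existence of a map
is essential: an empty real infimum is 0 by convention. -/
theorem vol_le_mul_lip (hT : T.IsTame) (hT' : T'.IsTame) [Nonempty (LipMap T T')] :
    T'.vol / T.vol ≤ Lip T T' := by
  have := hT.nontrivial
  have := hT.finite
  have := hT'.finite
  refine le_ciInf fun f => ?_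
  obtain ⟨K, hK, hf⟩ := f.exists_lipschitzWith
  rw [hf, div_le_iff₀ hT.vol_pos]
  exact vol_le_of_lipschitzWith hT'.minimal f.2.1 hK

theorem lip_pos (hT : T.IsTame) (hT' : T'.IsTame) [Nonempty (LipMap T T')] : 0 < Lip T T' :=
  (div_pos hT'.vol_pos hT.vol_pos).trans_le (vol_le_mul_lip hT hT')

theorem dLip_nonneg (hT : T.IsTame) (hT' : T'.IsTame) [Nonempty (LipMap T T')] :
    0 ≤ dLip T T' := by
  have h := vol_le_mul_lip hT hT'
  rw [div_le_iff₀ hT.vol_pos] at h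
  refine Real.log_nonneg ?_
  rwa [← mul_div_assoc, one_le_div hT'.vol_pos]

/-- Positivity of `Lip` turns the sum of logarithms into the logarithm of a product, in which the
volume of `T'` cancels. -/
theorem dLip_triangle (hT : T.IsTame) (hT' : T'.IsTame) (hT'' : T''.IsTame)
    [Nonempty (LipMap T T')] [Nonempty (LipMap T' T'')] [Nonempty (LipMap T T'')] :
    dLip T T'' ≤ dLip T T' + dLip T' T'' := by
  have h := hT.vol_pos
  have h' := hT'.vol_pos
  have h'' := hT''.vol_pos
  have l := lip_pos hT hT'
  have l' := lip_pos hT' hT''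
  rw [dLip, dLip, dLip, ← Real.log_mul (mul_pos l (div_pos h h')).ne'
    (mul_pos l' (div_pos h' h'')).ne']
  refine Real.log_le_log (mul_pos (lip_pos hT hT'') (div_pos h h'')) ?_
  have e : Lip T T' * (T.vol / T'.vol) * (Lip T' T'' * (T'.vol / T''.vol)) =
      Lip T T' * Lip T' T'' * (T.vol / T''.vol) := by
    field_simp
  rw [e]
  exact mul_le_mul_of_nonneg_right lip_le_mul (div_pos h h'').le

/-- A homothety of ratio ρ gives Lip ≤ ρ, and its ρ⁻¹-Lipschitz inverse gives ρ vol(T/G) ≤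
vol(T'/G). So the argument of the logarithm is at most 1, and `dLip_nonneg` gives the other
inequality. -/
theorem dLip_eq_zero_of_equivalent (hT : T.IsTame) (hT' : T'.IsTame) (h : Equivalent T T') :
    dLip T T' = 0 := by
  have := hT.nontrivial
  have := hT.finite
  have := hT'.nontrivial
  have := hT'.finite
  obtain ⟨φ', hφ'⟩ := h.symm
  obtain ⟨φ, hφ⟩ := h
  have hne : Nonempty (LipMap T T') := ⟨φ, hφ, _, Dilation.lipschitz φ⟩
  have hφs : ∀ (g : G) (x : T'.Realization), φ.symm (g • x) = g • φ.symm x := fun g x => by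
    apply φ.injective
    rw [hφ, DilationEquiv.apply_symm_apply, DilationEquiv.apply_symm_apply]
  have h2 := vol_le_of_lipschitzWith hT.minimal hφs (Dilation.lipschitz φ.symm)
  rw [DilationEquiv.ratio_symm, NNReal.coe_inv, ← div_eq_inv_mul,
    le_div_iff₀ (NNReal.coe_pos.2 (pos_iff_ne_zero.2 (Dilation.ratio_ne_zero φ)))] at h2
  refine le_antisymm ?_ (dLip_nonneg hT hT')
  have h3 : Lip T T' ≤ Dilation.ratio φ :=
    (lip_le ⟨φ, hφ, _, Dilation.lipschitz φ⟩).trans (LipMap.const_le (Dilation.lipschitz φ))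
  refine Real.log_nonpos (mul_nonneg lip_nonneg (div_pos hT.vol_pos hT'.vol_pos).le) ?_
  rw [← mul_div_assoc, div_le_one hT'.vol_pos]
  refine le_trans (mul_le_mul_of_nonneg_right h3 hT.vol_pos.le) ?_
  rwa [mul_comm]

end GTree

end

/-! ### Asymmetry: the group F₂ × ℤ acting on Cayley trees -/

noncomputable section

open scoped NNReal ENNReal

/-- The product of a free group of rank 2 with an infinite cyclic group. -/
abbrev FreeTimesInt : Type := FreeGroup Bool × Multiplicative ℤ

namespace FreeTimesInt

/-- The graph of groups with one vertex, two loops and only identity maps. -/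
def roseOfGroups : GraphOfGroups where
  V := Unit
  E := Bool
  o _ := ()
  t _ := ()
  Gv _ := Multiplicative ℤ
  Ge _ := Multiplicative ℤ
  ιo _ := MonoidHom.id _
  ιt _ := MonoidHom.id _
  ιo_injective _ := Function.injective_id
  ιt_injective _ := Function.injective_id

theorem isMaximalSubtree_empty : roseOfGroups.IsMaximalSubtree ∅ := by
  have h1 : Subsingleton roseOfGroups.V := inferInstanceAs (Subsingleton Unit)
  have h2 : Nonempty roseOfGroups.V := inferInstanceAs (Nonempty Unit)
  exact ⟨fun e he => absurd he (Set.notMem_empty e), Set.injOn_empty _,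
    SimpleGraph.IsTree.of_subsingleton⟩

/-- The inclusion of the vertex group. -/
def valHom (v : roseOfGroups.V) : roseOfGroups.Gv v →* FreeTimesInt :=
  MonoidHom.inr (FreeGroup Bool) (Multiplicative ℤ)

/-- The element of the group given by an edge. -/
def valEdge (e : roseOfGroups.E) : FreeTimesInt := MonoidHom.inl _ _ (FreeGroup.of (e : Bool))

theorem valEdge_conj (e : roseOfGroups.E) (h : roseOfGroups.Ge e) :
    valEdge e * valHom (roseOfGroups.t e) (roseOfGroups.ιt e h) * (valEdge e)⁻¹ =
      valHom (roseOfGroups.o e) (roseOfGroups.ιo e h) := by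
  have key : ∀ (w : FreeGroup Bool) (n : Multiplicative ℤ),
      ((w, 1) : FreeTimesInt) * (1, n) * (w, 1)⁻¹ = (1, n) := by
    intro w n
    simp
  exact key _ _

/-- The map from the fundamental group of the rose of groups. -/
def ofFundamentalGroup : roseOfGroups.FundamentalGroup ∅ →* FreeTimesInt :=
  PresentedGroup.toGroup (f := Sum.elim (fun x => valHom x.1 x.2) valEdge) (by
    rintro _ (⟨v, g, h⟩ | ⟨e, h⟩ | ⟨e, he⟩)
    · rw [GraphOfGroups.vgen, GraphOfGroups.vgen, GraphOfGroups.vgen, map_mul, map_mul, map_inv,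
        FreeGroup.lift_apply_of, FreeGroup.lift_apply_of, FreeGroup.lift_apply_of, Sum.elim_inl,
        Sum.elim_inl, Sum.elim_inl, map_mul, mul_inv_cancel]
    · rw [GraphOfGroups.vgen, GraphOfGroups.vgen, GraphOfGroups.egen, map_mul, map_mul, map_mul,
        map_inv, map_inv, FreeGroup.lift_apply_of, FreeGroup.lift_apply_of,
        FreeGroup.lift_apply_of, Sum.elim_inl, Sum.elim_inl, Sum.elim_inr, valEdge_conj,
        mul_inv_cancel]
    · exact absurd he (Set.notMem_empty e))

/-- The elements of the fundamental group of the rose given by the edges. -/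
def loopElt (i : Bool) : roseOfGroups.FundamentalGroup ∅ := roseOfGroups.edgeElt ∅ i

/-- The central subgroup of the fundamental group of the rose. -/
def centralHom : Multiplicative ℤ →* roseOfGroups.FundamentalGroup ∅ := roseOfGroups.vertexHom ∅ ()

theorem commute_loopElt (i : Bool) (n : Multiplicative ℤ) : Commute (loopElt i) (centralHom n) :=
  mul_inv_eq_iff_eq_mul.1 (roseOfGroups.edge_rel ∅ i n)

theorem ofFundamentalGroup_loopElt (i : Bool) :
    ofFundamentalGroup (loopElt i) = (FreeGroup.of i, 1) :=
  PresentedGroup.toGroup.of _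

theorem ofFundamentalGroup_centralHom (n : Multiplicative ℤ) :
    ofFundamentalGroup (centralHom n) = (1, n) :=
  PresentedGroup.toGroup.of _

theorem commute_lift (w : FreeGroup Bool) (n : Multiplicative ℤ) :
    Commute (FreeGroup.lift loopElt w) (centralHom n) := by
  induction w using FreeGroup.induction_on with
  | C1 => rw [map_one]; exact Commute.one_left _
  | of i => rw [FreeGroup.lift_apply_of]; exact commute_loopElt i n
  | inv_of i h => rw [map_inv]; exact h.inv_left
  | mul x y hx hy => rw [map_mul]; exact hx.mul_left hy

/-- The map to the fundamental group of the rose of groups. -/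
def toFundamentalGroup : FreeTimesInt →* roseOfGroups.FundamentalGroup ∅ :=
  MonoidHom.noncommCoprod (FreeGroup.lift loopElt) centralHom commute_lift

theorem toFundamentalGroup_apply (w : FreeGroup Bool) (n : Multiplicative ℤ) :
    toFundamentalGroup (w, n) = FreeGroup.lift loopElt w * centralHom n := rfl

/-- With identity edge maps the edge relations say that the two loops commute with the vertex group,
and no loop is killed because the maximal subtree has no edges. -/
theorem isGBS : IsGBS FreeTimesInt := by
  have hc : IsCyclic (Multiplicative ℤ) := inferInstance
  have hi : Infinite (Multiplicative ℤ) := inferInstance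
  refine ⟨roseOfGroups, ∅, inferInstanceAs (Finite Unit), inferInstanceAs (Finite Bool),
    fun _ => ⟨hc, hi⟩, fun _ => ⟨hc, hi⟩, isMaximalSubtree_empty,
    ⟨MonoidHom.toMulEquiv toFundamentalGroup ofFundamentalGroup ?_ ?_⟩⟩
  · have h1 : ofFundamentalGroup.comp (FreeGroup.lift loopElt) =
        MonoidHom.inl (FreeGroup Bool) (Multiplicative ℤ) := by
      apply FreeGroup.ext_hom
      intro i
      rw [MonoidHom.comp_apply, FreeGroup.lift_apply_of, ofFundamentalGroup_loopElt,
        MonoidHom.inl_apply]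
    apply MonoidHom.ext
    rintro ⟨w, n⟩
    have h2 : ofFundamentalGroup (FreeGroup.lift loopElt w) = (w, 1) := DFunLike.congr_fun h1 w
    rw [MonoidHom.comp_apply, toFundamentalGroup_apply, map_mul, h2,
      ofFundamentalGroup_centralHom]
    simp
  · have key : ∀ (i : Bool), toFundamentalGroup (FreeGroup.of i, 1) = loopElt i := fun i => by
      rw [toFundamentalGroup_apply, FreeGroup.lift_apply_of, map_one, mul_one]
    have key' : ∀ (n : Multiplicative ℤ), toFundamentalGroup (1, n) = centralHom n := fun n => by
      rw [toFundamentalGroup_apply, map_one, one_mul]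
    apply PresentedGroup.ext
    rintro (⟨v, n⟩ | i)
    · exact (congrArg toFundamentalGroup (ofFundamentalGroup_centralHom n)).trans (key' n)
    · exact (congrArg toFundamentalGroup (ofFundamentalGroup_loopElt i)).trans (key i)

/-- The free factor maps onto the symmetric group on five letters, which a 5-cycle and a
transposition generate. -/
theorem not_isSolvable : ¬ Group.IsSolvable FreeTimesInt := by
  intro h
  let φ : FreeGroup Bool →* Equiv.Perm (Fin 5) :=
    FreeGroup.lift fun i => if i then finRotate 5 else Equiv.swap 0 1
  have hφ : Function.Surjective φ := by
    rw [← MonoidHom.range_eq_top, eq_top_iff]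
    have hcl := Equiv.Perm.closure_prime_cycle_swap (α := Fin 5) (σ := finRotate 5)
      (τ := Equiv.swap 0 1) (by norm_num) isCycle_finRotate support_finRotate
      ⟨0, 1, by decide, rfl⟩
    rw [← hcl, Subgroup.closure_le]
    rintro _ (rfl | rfl)
    · exact ⟨FreeGroup.of true, by simp [φ]⟩
    · exact ⟨FreeGroup.of false, by simp [φ]⟩
  have hsurj : Function.Surjective (φ.comp (MonoidHom.fst (FreeGroup Bool) (Multiplicative ℤ))) :=
    hφ.comp Prod.fst_surjective
  exact Equiv.Perm.not_isSolvable_fin_5 (Group.isSolvable_of_surjective hsurj)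

/-- The exponent sum of a generator. -/
def expSum (i : Bool) : FreeGroup Bool →* Multiplicative ℤ :=
  FreeGroup.lift fun j => Multiplicative.ofAdd (if j = i then 1 else 0)

/-- The exponent sum of a generator, as a real number. -/
def expSumReal (i : Bool) (w : FreeGroup Bool) : ℝ := (Multiplicative.toAdd (expSum i w) : ℤ)

theorem expSumReal_mul (i : Bool) (x y : FreeGroup Bool) :
    expSumReal i (x * y) = expSumReal i x + expSumReal i y := by
  rw [expSumReal, map_mul, toAdd_mul, Int.cast_add]
  rfl

theorem expSumReal_of (i j : Bool) : expSumReal i (FreeGroup.of j) = if j = i then 1 else 0 := by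
  rw [expSumReal, expSum, FreeGroup.lift_apply_of]
  split_ifs <;> simp

/-- The Cayley graph of the free group of rank 2. -/
def cayleyGraph : SimpleGraph (FreeGroup Bool) where
  Adj x y := ∃ i, y = FreeGroup.of i * x ∨ x = FreeGroup.of i * y
  symm := ⟨fun x y ⟨i, h⟩ => ⟨i, h.symm⟩⟩
  loopless := ⟨by
    rintro x ⟨i, h⟩
    have h' : x = FreeGroup.of i * x := h.elim id id
    have := congrArg (expSumReal i) h'
    rw [expSumReal_mul, expSumReal_of, if_pos rfl] at this
    linarith⟩

theorem cayleyGraph_adj (i : Bool) (x : FreeGroup Bool) : cayleyGraph.Adj x (FreeGroup.of i * x) :=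
  ⟨i, Or.inl rfl⟩

theorem cayleyGraph_connected : cayleyGraph.Connected := by
  have key : ∀ w x : FreeGroup Bool, cayleyGraph.Reachable x (w * x) := by
    intro w
    induction w using FreeGroup.induction_on with
    | C1 => intro x; rw [one_mul]
    | of i => exact fun x => (cayleyGraph_adj i x).reachable
    | inv_of i _ =>
      intro x
      have := (cayleyGraph_adj i ((FreeGroup.of i)⁻¹ * x)).reachable
      rw [mul_inv_cancel_left] at this
      exact this.symm
    | mul w z hw hz =>
      intro x
      rw [mul_assoc]
      exact (hz x).trans (hw _)
  rw [SimpleGraph.connected_iff]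
  refine ⟨fun x y => ?_, ⟨1⟩⟩
  have := key (y * x⁻¹) x
  rwa [inv_mul_cancel_right] at this

/-- Left multiplication by a generator alters only the front of a reduced word. The last letter is
affected only if the word is empty or is the single cancelling letter (j, false), which is never (i,
true). -/
theorem getLast_toWord_of_mul (i j : Bool) (x : FreeGroup Bool) (h : ¬ (x = 1 ∧ j = i)) :
    (FreeGroup.of j * x).toWord.getLast? = some (i, true) ↔ x.toWord.getLast? = some (i, true) := by
  have hr : (FreeGroup.of j * x).toWord = FreeGroup.reduce ((j, true) :: x.toWord) := by
    rw [FreeGroup.toWord_mul, FreeGroup.toWord_of]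
    rfl
  rw [hr, FreeGroup.reduce.cons, FreeGroup.reduce_toWord]
  rcases hx : x.toWord with _ | ⟨hd, tl⟩
  · have hx1 : x = 1 := FreeGroup.toWord_eq_nil_iff.1 hx
    have hji : j ≠ i := fun hji => h ⟨hx1, hji⟩
    simp [hji]
  · simp only
    split_ifs with hc
    · rcases tl with _ | ⟨a, tl⟩
      · obtain ⟨a, b⟩ := hd
        simp only [Bool.true_eq, Bool.not_eq_true'] at hc
        simp [hc.2]
      · rw [List.getLast?_cons_cons]
    · rw [List.getLast?_cons_cons]

/-- Every edge is a bridge. Whether the reduced word of `y * x⁻¹` ends in the letter `i` is constant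
along walks of `y` avoiding the edge from `x` to `of i * x`, but it differs at the two ends of this
edge. -/
theorem cayleyGraph_isTree : cayleyGraph.IsTree := by
  refine ⟨cayleyGraph_connected, ?_⟩
  rw [SimpleGraph.isAcyclic_iff_forall_adj_isBridge]
  have key : ∀ (i : Bool) (x : FreeGroup Bool),
      cayleyGraph.IsBridge s(x, FreeGroup.of i * x) := by
    intro i x
    rw [SimpleGraph.isBridge_iff]
    rintro ⟨p⟩
    have step : ∀ (j : Bool) (y : FreeGroup Bool),
        s(y, FreeGroup.of j * y) ≠ s(x, FreeGroup.of i * x) →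
        ((FreeGroup.of j * y * x⁻¹).toWord.getLast? = some (i, true) ↔
          (y * x⁻¹).toWord.getLast? = some (i, true)) := by
      intro j y hne
      rw [mul_assoc]
      apply getLast_toWord_of_mul
      rintro ⟨hy, rfl⟩
      rw [mul_inv_eq_one] at hy
      exact hne (by rw [hy])
    have inv : ∀ (y z : FreeGroup Bool)
        (_ : (cayleyGraph.deleteEdges {s(x, FreeGroup.of i * x)}).Walk y z),
        ((z * x⁻¹).toWord.getLast? = some (i, true) ↔
          (y * x⁻¹).toWord.getLast? = some (i, true)) := by
      intro y z p
      induction p with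
      | nil => rfl
      | @cons y w z h p ih =>
        rw [ih]
        rw [SimpleGraph.deleteEdges_adj, Set.mem_singleton_iff] at h
        obtain ⟨⟨j, rfl | rfl⟩, hne⟩ := h
        · exact step j y hne
        · rw [Sym2.eq_swap] at hne
          exact (step j w hne).symm
    have := inv _ _ p
    rw [mul_inv_cancel_right, mul_inv_cancel, FreeGroup.toWord_of, FreeGroup.toWord_one] at this
    simp at this
  rintro x y ⟨i, rfl | rfl⟩
  · exact key i x
  · rw [Sym2.eq_swap]
    exact key i y

/-- The function on pairs of vertices giving the lengths of the edges. -/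
def cayleyLen (l : Bool → ℝ) : Sym2 (FreeGroup Bool) → ℝ :=
  Sym2.lift ⟨fun x y => ∑ i, l i * |expSumReal i x - expSumReal i y|, fun x y => by
    simp only [abs_sub_comm]⟩

theorem cayleyLen_mk (l : Bool → ℝ) (x y : FreeGroup Bool) :
    cayleyLen l s(x, y) = ∑ i, l i * |expSumReal i x - expSumReal i y| := rfl

/-- Along an edge labelled `j` only the exponent sum of `j` changes, and it changes by one. -/
theorem cayleyLen_of_mul (l : Bool → ℝ) (j : Bool) (x : FreeGroup Bool) :
    cayleyLen l s(x, FreeGroup.of j * x) = l j := by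
  rw [cayleyLen_mk, Fintype.sum_bool]
  cases j <;> simp [expSumReal_mul, expSumReal_of]

/-- The Cayley tree of the free group, with edges of prescribed lengths, and the infinite cyclic
factor acting trivially. -/
def cayleyTree (l : Bool → ℝ) (hl : ∀ i, 0 < l i) : GTree.{0, 0} FreeTimesInt where
  V := FreeGroup Bool
  graph := cayleyGraph
  isTree := cayleyGraph_isTree
  action :=
    -- Edges come from left multiplication, so the group acts by right multiplication, inverted to
    -- give a left action.
    { smul := fun g x => x * g.1⁻¹
      one_smul := fun x => by
        change x * (1 : FreeTimesInt).1⁻¹ = x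
        simp
      mul_smul := fun g h x => by
        change x * (g * h).1⁻¹ = x * h.1⁻¹ * g.1⁻¹
        simp [mul_assoc] }
  adj_smul := by
    rintro g x y ⟨i, rfl | rfl⟩
    · exact ⟨i, Or.inl (mul_assoc _ _ _)⟩
    · exact ⟨i, Or.inr (mul_assoc _ _ _)⟩
  no_inversion := by
    rintro g x y h ⟨h1, h2⟩
    change x * g.1⁻¹ = y at h1
    change y * g.1⁻¹ = x at h2
    -- An element exchanging `x` and `y` shifts each exponent sum by the same amount both ways, so
    -- the shift is zero; but adjacent vertices differ in one exponent sum.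
    have e : ∀ i, expSumReal i x = expSumReal i y := by
      intro i
      have e1 := congrArg (expSumReal i) h1
      have e2 := congrArg (expSumReal i) h2
      rw [expSumReal_mul] at e1 e2
      linarith
    obtain ⟨i, rfl | rfl⟩ := h
    · have := e i
      rw [expSumReal_mul, expSumReal_of, if_pos rfl] at this
      linarith
    · have := e i
      rw [expSumReal_mul, expSumReal_of, if_pos rfl] at this
      linarith
  len := cayleyLen l
  len_pos := by
    rintro x y ⟨i, rfl | rfl⟩
    · rw [cayleyLen_of_mul]; exact hl i
    · rw [Sym2.eq_swap, cayleyLen_of_mul]; exact hl i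
  len_smul := by
    intro g x y _
    change cayleyLen l s(x * g.1⁻¹, y * g.1⁻¹) = cayleyLen l s(x, y)
    simp only [cayleyLen_mk, expSumReal_mul, add_sub_add_right_eq_sub]

variable {l : Bool → ℝ} {hl : ∀ i, 0 < l i}

/-- The vertex given by an element of the free group. -/
def vert (l : Bool → ℝ) (hl : ∀ i, 0 < l i) (x : FreeGroup Bool) : (cayleyTree l hl).V := x

/-- The element of the free group that is the given vertex. -/
def word (x : (cayleyTree l hl).V) : FreeGroup Bool := x

theorem vert_word (x : (cayleyTree l hl).V) : vert l hl (word x) = x := rfl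

theorem word_vert (x : FreeGroup Bool) : word (vert l hl x) = x := rfl

theorem word_smul (g : FreeTimesInt) (x : (cayleyTree l hl).V) : word (g • x) = word x * g.1⁻¹ :=
  rfl

theorem smul_vert (g : FreeTimesInt) (x : FreeGroup Bool) :
    g • vert l hl x = vert l hl (x * g.1⁻¹) := rfl

theorem adj_vert (i : Bool) (x : FreeGroup Bool) :
    (cayleyTree l hl).graph.Adj (vert l hl x) (vert l hl (FreeGroup.of i * x)) :=
  cayleyGraph_adj i x

theorem exists_of_adj {x y : (cayleyTree l hl).V} (h : (cayleyTree l hl).graph.Adj x y) :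
    ∃ i, word y = FreeGroup.of i * word x ∨ word x = FreeGroup.of i * word y := h

theorem len_eq (x y : (cayleyTree l hl).V) : (cayleyTree l hl).len s(x, y) =
    ∑ i, l i * |expSumReal i (word x) - expSumReal i (word y)| := rfl

theorem len_vert (i : Bool) (x : FreeGroup Bool) :
    (cayleyTree l hl).len s(vert l hl x, vert l hl (FreeGroup.of i * x)) = l i :=
  cayleyLen_of_mul l i x

theorem vert_injective : Function.Injective (vert l hl) := fun _ _ h => h

/-- The free factor acts simply transitively on the vertices: transitivity gives minimality, and
freeness embeds stabilizers in the infinite cyclic factor. -/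
theorem isCyclicMinimal : (cayleyTree l hl).IsCyclicMinimal := by
  have hst : ∀ (x : (cayleyTree l hl).V) (H : Subgroup FreeTimesInt),
      H ≤ MulAction.stabilizer FreeTimesInt x → IsCyclic H := by
    intro x H hH
    refine isCyclic_of_injective
      ((MonoidHom.snd (FreeGroup Bool) (Multiplicative ℤ)).comp H.subtype) ?_
    rw [injective_iff_map_eq_one]
    rintro ⟨⟨w, n⟩, hg⟩ hn
    have hn' : n = 1 := hn
    have hw : word x * w⁻¹ = word x := congrArg word (MulAction.mem_stabilizer_iff.1 (hH hg))
    rw [mul_eq_left, inv_eq_one] at hw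
    subst hn' hw
    rfl
  refine ⟨fun S hS hconn => ?_, fun x => hst x _ le_rfl, fun x y _ => hst x _ inf_le_left⟩
  obtain ⟨⟨x, hx⟩⟩ := hconn.nonempty
  rw [Set.eq_univ_iff_forall]
  intro y
  have := hS ((word y)⁻¹ * word x, 1) x hx
  rw [← vert_word x, smul_vert, word_vert] at this
  rwa [mul_inv_rev, inv_inv, mul_inv_cancel_left, vert_word] at this

/-- There is one orbit of edges for each generator; exponent sums rule out an identification of
edges that reverses orientation. -/
theorem vol_eq : (cayleyTree l hl).vol = l true + l false := by
  let e : Bool → (cayleyTree l hl).QuotientEdge := fun i =>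
    Quotient.mk'' ⟨s(vert l hl 1, vert l hl (FreeGroup.of i * 1)), adj_vert (l := l) (hl := hl) i 1⟩
  have he : Function.Bijective e := by
    constructor
    · intro i j hij
      obtain ⟨g, hg⟩ := (GTree.quotientEdge_mk_eq (adj_vert i 1) (adj_vert j 1)).1 hij
      rw [smul_vert, smul_vert, Sym2.eq_iff, mul_one, mul_one, one_mul, vert_injective.eq_iff,
        vert_injective.eq_iff, vert_injective.eq_iff, vert_injective.eq_iff] at hg
      rcases hg with ⟨h1, h2⟩ | ⟨h1, h2⟩
      · rw [h1, mul_one] at h2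
        exact (FreeGroup.of_injective h2).symm
      · rw [h1] at h2
        have h3 := congrArg (expSumReal i) h2
        rw [expSumReal_mul, expSumReal_of, expSumReal_of, if_pos rfl] at h3
        have h4 : expSumReal i 1 = 0 := by simp [expSumReal]
        rw [h4] at h3
        split_ifs at h3 <;> linarith
    · intro q
      obtain ⟨x, y, hxy, rfl, -⟩ := (cayleyTree l hl).exists_quotientEdge_rep q
      obtain ⟨i, h⟩ := exists_of_adj hxy
      refine ⟨i, ?_⟩
      rcases h with h | h
      · refine (GTree.quotientEdge_mk_eq (adj_vert i 1) hxy).2 ⟨(word x, 1), ?_⟩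
        rw [← vert_word y, h, ← vert_word x, word_vert, smul_vert, smul_vert, mul_inv_cancel,
          mul_inv_cancel_right, mul_one]
      · refine (GTree.quotientEdge_mk_eq (adj_vert i 1) hxy).2 ⟨(word y, 1), ?_⟩
        rw [← vert_word x, h, ← vert_word y, word_vert, smul_vert, smul_vert, mul_inv_cancel,
          mul_inv_cancel_right, mul_one, Sym2.eq_swap]
  rw [GTree.vol, ← finsum_eq_of_bijective e he (f := l) (fun i => (len_vert i 1).symm),
    finsum_eq_sum_of_fintype, Fintype.sum_bool]

variable {l' : Bool → ℝ} {hl' : ∀ i, 0 < l' i}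

/-- The map that keeps barycentric coordinates is equivariant and stretches edges labelled `i` by l'
i / l i. -/
theorem lip_le_of_forall (K : ℝ≥0) (hK : ∀ i, l' i ≤ K * l i) :
    GTree.Lip (cayleyTree l hl) (cayleyTree l' hl') ≤ K := by
  let f : (cayleyTree l hl).Realization → (cayleyTree l' hl').Realization := fun x => ⟨x.1, x.2⟩
  have hlen : ∀ a b : (cayleyTree l hl).V, (cayleyTree l' hl').len s(vert l' hl' (word a),
      vert l' hl' (word b)) ≤ K * (cayleyTree l hl).len s(a, b) := by
    intro a b
    rw [len_eq, len_eq, Finset.mul_sum]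
    refine Finset.sum_le_sum fun i _ => ?_
    rw [← mul_assoc]
    exact mul_le_mul_of_nonneg_right (hK i) (abs_nonneg _)
  have hf : LipschitzWith K f := by
    apply GTree.lipschitzWith_of_edges
    intro a b hab x y hx hy
    refine (GTree.edist_le_of_pathLen (GTree.PathLen.cons (T := cayleyTree l' hl') (x := f x)
      (y := f y) a b hab hx hy (GTree.PathLen.nil _))).trans ?_
    rw [add_zero, ← ENNReal.ofReal_coe_nnreal, ← ENNReal.ofReal_mul K.coe_nonneg, ← mul_assoc]
    exact ENNReal.ofReal_le_ofReal (mul_le_mul_of_nonneg_right (hlen a b) (abs_nonneg _))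
  let k : GTree.LipMap (cayleyTree l hl) (cayleyTree l' hl') := ⟨f, fun g x => rfl, K, hf⟩
  exact (GTree.lip_le k).trans (GTree.LipMap.const_le (f := k) hf)

/-- The height given by l' i times the exponent sum of `i` is 1-Lipschitz on the target, and a
suitable `g` raises it by exactly l' i everywhere. The same `g` moves a vertex of the source by at
most l i, so a `K`-Lipschitz equivariant map has l' i ≤ K l i. -/
theorem div_le_lip (i : Bool)
    [Nonempty (GTree.LipMap (cayleyTree l hl) (cayleyTree l' hl'))] :
    l' i / l i ≤ GTree.Lip (cayleyTree l hl) (cayleyTree l' hl') := by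
  refine le_ciInf fun f => ?_
  obtain ⟨K, hK, hf⟩ := f.exists_lipschitzWith
  rw [hf, div_le_iff₀ (hl i)]
  let φ : (cayleyTree l' hl').V → ℝ := fun x => l' i * expSumReal i (word x)
  have hφ : LipschitzWith 1 (GTree.affineExt φ) := by
    apply GTree.lipschitzWith_affineExt
    intro a b _
    rw [NNReal.coe_one, one_mul, ← mul_sub, abs_mul, abs_of_pos (hl' i), len_eq]
    exact Finset.single_le_sum
      (f := fun i => l' i * |expSumReal i (word a) - expSumReal i (word b)|)
      (fun i _ => mul_nonneg (hl' i).le (abs_nonneg _)) (Finset.mem_univ i)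
  let x : (cayleyTree l hl).Realization := (cayleyTree l hl).vertexPt (vert l hl 1)
  let g : FreeTimesInt := ((FreeGroup.of i)⁻¹, 1)
  have h1 : edist x (g • x) ≤ ENNReal.ofReal (l i) := by
    have e0 : x = GTree.edgePt (adj_vert i 1) 0 := (GTree.edgePt_zero _).symm
    have e1 : g • x = GTree.edgePt (adj_vert i 1) 1 := by
      rw [GTree.edgePt_one, GTree.smul_vertexPt, smul_vert, inv_inv, one_mul, mul_one]
    rw [e1, e0]
    have := GTree.lipschitzWith_edgePt (adj_vert (l := l) (hl := hl) i 1) 0 1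
    refine this.trans ?_
    rw [edist_dist, Real.dist_eq, zero_sub, abs_neg, abs_one, ENNReal.ofReal_one, mul_one]
    exact ENNReal.ofReal_le_ofReal (len_vert i 1).le
  have h2 : ∀ y : (cayleyTree l' hl').Realization,
      GTree.affineExt φ (g • y) = GTree.affineExt φ y + l' i := by
    intro y
    obtain ⟨a, b, -, s, -, hy⟩ := y.2
    have hg : ∀ a : (cayleyTree l' hl').V, φ (g • a) = φ a + l' i := by
      intro a
      simp only [φ, word_smul, g, inv_inv, expSumReal_mul, expSumReal_of, if_true]
      ring
    rw [GTree.affineExt_smul, GTree.affineExt_of_val _ hy, GTree.affineExt_of_val _ hy, hg, hg]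
    ring
  have h3 := (hφ.comp hK) x (g • x)
  rw [Function.comp, Function.comp, f.2.1, h2, edist_dist, Real.dist_eq, sub_add_cancel_left, abs_neg,
    abs_of_pos (hl' i), one_mul] at h3
  have h4 := h3.trans (mul_le_mul_right h1 _)
  rwa [← ENNReal.ofReal_coe_nnreal, ← ENNReal.ofReal_mul K.coe_nonneg,
    ENNReal.ofReal_le_ofReal_iff (mul_nonneg K.coe_nonneg (hl i).le)] at h4

/-- The Lipschitz metric is not symmetric. -/
theorem exists_dLip_ne : ∃ T T' : GTree.{0, 0} FreeTimesInt, T.IsCyclicMinimal ∧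
    T'.IsCyclicMinimal ∧ GTree.dLip T T' ≠ GTree.dLip T' T := by
  -- Both choices of lengths have total 4, so the volumes cancel and only the stretch factors
  -- matter: at least 2 / 1 one way, at most 3 / 2 the other.
  let l : Bool → ℝ := fun i => if i then 1 else 3
  have hl : ∀ i, 0 < l i := by intro i; cases i <;> simp [l]
  let l' : Bool → ℝ := fun _ => 2
  have hl' : ∀ i, 0 < l' i := fun _ => by simp [l']
  refine ⟨cayleyTree l hl, cayleyTree l' hl', isCyclicMinimal, isCyclicMinimal, ?_⟩
  have hne : Nonempty (GTree.LipMap (cayleyTree l hl) (cayleyTree l' hl')) :=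
    isCyclicMinimal.nonempty_lipMap isGBS not_isSolvable isCyclicMinimal
  have hne' : Nonempty (GTree.LipMap (cayleyTree l' hl') (cayleyTree l hl)) :=
    isCyclicMinimal.nonempty_lipMap isGBS not_isSolvable isCyclicMinimal
  have h1 : 2 ≤ GTree.Lip (cayleyTree l hl) (cayleyTree l' hl') := by
    have := div_le_lip (l := l) (hl := hl) (l' := l') (hl' := hl') true
    simpa [l, l'] using this
  have h2 : GTree.Lip (cayleyTree l' hl') (cayleyTree l hl) ≤ (3 / 2 : ℝ≥0) :=
    lip_le_of_forall _ fun i => by cases i <;> norm_num [l, l']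
  have h3 : 0 < GTree.Lip (cayleyTree l' hl') (cayleyTree l hl) := by
    have := div_le_lip (l := l') (hl := hl') (l' := l) (hl' := hl) true
    refine lt_of_lt_of_le ?_ this
    norm_num [l, l']
  have hv : (cayleyTree l hl).vol = 4 := by rw [vol_eq]; norm_num [l]
  have hv' : (cayleyTree l' hl').vol = 4 := by rw [vol_eq]; norm_num [l']
  rw [GTree.dLip, GTree.dLip, hv, hv', div_self (by norm_num), mul_one, mul_one]
  refine (Real.log_lt_log h3 ?_).ne'
  push_cast at h2
  linarith

end FreeTimesInt

end

/-! ### The main theorem -/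

theorem mainTheorem7 :
    (∀ (G : Type u) [Group G], IsGBS G → ¬ Group.IsSolvable G →
      (∀ T T' : GTree.{u, v} G, T.IsCyclicMinimal → T'.IsCyclicMinimal →
        (Finite T.QuotientEdge ∧ 0 < T.vol ∧
          Nonempty (GTree.LipMap T T') ∧ 0 < GTree.Lip T T') ∧
        0 ≤ GTree.dLip T T') ∧
      (∀ S S' T T' : GTree.{u, v} G, S.IsCyclicMinimal → S'.IsCyclicMinimal →
        T.IsCyclicMinimal → T'.IsCyclicMinimal → GTree.Equivalent S T → GTree.Equivalent S' T' →
        GTree.dLip S S' = GTree.dLip T T') ∧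
      (∀ T T' T'' : GTree.{u, v} G, T.IsCyclicMinimal → T'.IsCyclicMinimal →
        T''.IsCyclicMinimal →
        GTree.dLip T T'' ≤ GTree.dLip T T' + GTree.dLip T' T'')) ∧
    (∃ (G : Type) (_ : Group G), IsGBS G ∧ ¬ Group.IsSolvable G ∧
      ∃ T T' : GTree.{0, 0} G, T.IsCyclicMinimal ∧ T'.IsCyclicMinimal ∧
        GTree.dLip T T' ≠ GTree.dLip T' T) := by
  refine ⟨fun G _ hG hns => ?_, FreeTimesInt, inferInstance, FreeTimesInt.isGBS,
    FreeTimesInt.not_isSolvable, FreeTimesInt.exists_dLip_ne⟩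
  have hcount : Countable G := hG.fg_and_exists_commensurated.1.to_countable
  have triangle : ∀ T T' T'' : GTree.{u, v} G, T.IsCyclicMinimal → T'.IsCyclicMinimal →
      T''.IsCyclicMinimal → GTree.dLip T T'' ≤ GTree.dLip T T' + GTree.dLip T' T'' := by
    intro T T' T'' hT hT' hT''
    have := hT.nonempty_lipMap hG hns hT'
    have := hT'.nonempty_lipMap hG hns hT''
    have := hT.nonempty_lipMap hG hns hT''
    exact GTree.dLip_triangle (hT.isTame hG hns) (hT'.isTame hG hns) (hT''.isTame hG hns)
  -- The route from `S` to `S'` through `T` and `T'` costs nothing in its first and last legs.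
  -- Exchanging the two pairs gives the reverse inequality.
  have mono : ∀ S S' T T' : GTree.{u, v} G, S.IsCyclicMinimal → S'.IsCyclicMinimal →
      T.IsCyclicMinimal → T'.IsCyclicMinimal → GTree.Equivalent S T → GTree.Equivalent S' T' →
      GTree.dLip S S' ≤ GTree.dLip T T' := by
    intro S S' T T' hS hS' hT hT' h h'
    have h1 := triangle S T S' hS hT hS'
    have h2 := triangle T T' S' hT hT' hS'
    rw [GTree.dLip_eq_zero_of_equivalent (hS.isTame hG hns) (hT.isTame hG hns) h] at h1
    rw [GTree.dLip_eq_zero_of_equivalent (hT'.isTame hG hns) (hS'.isTame hG hns) h'.symm] at h2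
    linarith
  refine ⟨fun T T' hT hT' => ?_, fun S S' T T' hS hS' hT hT' h h' => ?_, triangle⟩
  · have hne := hT.nonempty_lipMap hG hns hT'
    have hTt := hT.isTame hG hns
    have hTt' := hT'.isTame hG hns
    exact ⟨⟨hTt.finite, hTt.vol_pos, hne, GTree.lip_pos hTt hTt'⟩, GTree.dLip_nonneg hTt hTt'⟩
  · exact le_antisymm (mono S S' T T' hS hS' hT hT' h h')
      (mono T T' S S' hT hT' hS hS' h.symm h'.symm)
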